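/- Let $\mathbb R^+=(0,\infty)$, $\mathbb C^+=\{z\in\mathbb C:\Re z>0\}$ and $\alpha>0$. For measurable $f:\mathbb R^+\to\mathbb C$ put $$\mathcal C_\alpha f(s)=\frac{\alpha}{s^\alpha}\int_0^s(s-u)^{\alpha-1}f(u)\,du,\qquad \mathcal C^*_\alpha f(s)=\alpha\int_s^\infty\frac{(u-s)^{\alpha-1}}{u^\alpha}f(u)\,du\qquad(s>0),$$ and $\mathcal L f(z)=\int_0^\infty e^{-zt}f(t)\,dt$ for $z\in\mathbb C^+$. For $1\le r\le\infty$ let $H_r(\mathbb C^+)$ be the Banach space of holomorphic functions $F$ on $\mathbb C^+$ with $\|F\|_r=\sup_{x>0}\big(\frac1{2\pi}\int_{-\infty}^{\infty}|F(x+iy)|^r\,dy\big)^{1/r}<\infty$ (the supremum norm if $r=\infty$), and let $\mathcal A_0(\mathbb C^+)\subset H_\infty(\mathbb C^+)$ be the subspace of those $F$ that extend continuously to $\overline{\mathbb C^+}$ with limit $0$ at infinity. Put $T_r(t)F(z)=e^{-t/r}F(e^{-t}z)$ for $t\in\mathbb R$ (with $t/\infty=0$). For $1\le p<\infty$ and $\frac1p+\frac1q=1$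 put $\varphi_{\alpha,p}(t)=\alpha(1-e^{-t})^{\alpha-1}e^{-t/p}$ and $$\mathfrak C^*_\alpha F=\int_0^\infty\varphi_{\alpha,p}(t)\,T_p(-t)F\,dt,\qquad \mathfrak C_\alpha G=\int_0^\infty\varphi_{\alpha,p}(t)\,T_q(t)G\,dt,$$ as Bochner integrals in $H_p(\mathbb C^+)$ and $H_q(\mathbb C^+)$ respectively, for those $F\in H_p(\mathbb C^+)$, $G\in H_q(\mathbb C^+)$ for which the integrand is Bochner integrable. Then the Laplace transform intertwines the real and the complex operators. (1) Let $1\le p\le2$, $\frac1p+\frac1q=1$ and $f\in L_p(\mathbb R^+)$. The integral defining $\mathcal C^*_\alpha f(s)$ converges absolutely for almost every $s>0$, $\mathcal C^*_\alpha f\in L_p(\mathbb R^+)$, the integrals defining $\mathcal L f$ and $\mathcal L(\mathcal C^*_\alpha f)$ converge absolutely on $\mathbb C^+$, $\mathcal L f\in H_q(\mathbb C^+)$ (and $\mathcal L f\in\mathcal A_0(\mathbb C^+)$ if $p=1$), the integral defining $\mathfrak C_\alpha(\mathcal L f)$ converges in the Bochner sense in $H_q(\mathbb C^+)$, and $$\mathcal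 L(\mathcal C^*_\alpha f)=\mathfrak C_\alpha(\mathcal L f)\quad\text{on }\mathbb C^+.$$ (2) Let $1<q\le2$, $\frac1p+\frac1q=1$ and $f\in L_q(\mathbb R^+)$. The integral defining $\mathcal C_\alpha f(s)$ converges absolutely for almost every $s>0$, $\mathcal C_\alpha f\in L_q(\mathbb R^+)$, the integrals defining $\mathcal L f$ and $\mathcal L(\mathcal C_\alpha f)$ converge absolutely on $\mathbb C^+$, $\mathcal L f\in H_p(\mathbb C^+)$, the integral defining $\mathfrak C^*_\alpha(\mathcal L f)$ converges in the Bochner sense in $H_p(\mathbb C^+)$, and $$\mathcal L(\mathcal C_\alpha f)=\mathfrak C^*_\alpha(\mathcal L f)\quad\text{on }\mathbb C^+.$$ -/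

import Mathlib

open MeasureTheory Set Filter Topology
open scoped ENNReal

noncomputable section
namespace CesaroHardy

/-- Lebesgue measure on `ℝ⁺ = (0, ∞)`. -/
def halfLine : Measure ℝ := volume.restrict (Ioi 0)

/-- The open right half-plane `ℂ⁺`. -/
def rightHalfPlane : Set ℂ := {z | 0 < z.re}

/-- The measure `dy / 2π` on the real line. -/
def lineMeasure : Measure ℝ := ENNReal.ofReal (1 / (2 * Real.pi)) • volume

/-- The extended Hardy norm `sup_{x > 0} (1/2π ∫ |F(x + iy)|^p dy)^{1/p}`
(for `p = ∞` the integral is replaced by the essential supremum over the line). -/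
def hardyNorm (p : ℝ≥0∞) (F : ℂ → ℂ) : ℝ≥0∞ :=
  ⨆ x : Ioi (0 : ℝ), eLpNorm (fun y : ℝ => F ((x : ℝ) + y * Complex.I)) p lineMeasure

lemma isOpen_rightHalfPlane : IsOpen rightHalfPlane :=
  isOpen_lt continuous_const Complex.continuous_re

lemma continuous_slice {F : ℂ → ℂ} (hF : DifferentiableOn ℂ F rightHalfPlane) {x : ℝ}
    (hx : 0 < x) : Continuous (fun y : ℝ => F (x + y * Complex.I)) := by
  refine hF.continuousOn.comp_continuous (by fun_prop) fun y => ?_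
  simpa [rightHalfPlane] using hx

lemma eLpNorm_slice_le (p : ℝ≥0∞) (F : ℂ → ℂ) {x : ℝ} (hx : 0 < x) :
    eLpNorm (fun y : ℝ => F (x + y * Complex.I)) p lineMeasure ≤ hardyNorm p F :=
  le_iSup (fun x : Ioi (0 : ℝ) =>
    eLpNorm (fun y : ℝ => F ((x : ℝ) + y * Complex.I)) p lineMeasure) ⟨x, hx⟩

lemma hardyNorm_zero (p : ℝ≥0∞) : hardyNorm p 0 = 0 := by
  simp [hardyNorm]

lemma hardyNorm_add_le {p : ℝ≥0∞} (hp : 1 ≤ p) {F G : ℂ → ℂ}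
    (hF : DifferentiableOn ℂ F rightHalfPlane) (hG : DifferentiableOn ℂ G rightHalfPlane) :
    hardyNorm p (F + G) ≤ hardyNorm p F + hardyNorm p G := by
  refine iSup_le fun ⟨x, hx⟩ => ?_
  refine (eLpNorm_add_le (continuous_slice hF hx).aestronglyMeasurable
    (continuous_slice hG hx).aestronglyMeasurable hp).trans ?_
  exact add_le_add (eLpNorm_slice_le p F hx) (eLpNorm_slice_le p G hx)

lemma hardyNorm_smul (p : ℝ≥0∞) (c : ℂ) (F : ℂ → ℂ) :
    hardyNorm p (c • F) = ‖c‖ₑ * hardyNorm p F := by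
  unfold hardyNorm
  rw [ENNReal.mul_iSup]
  refine iSup_congr fun x => ?_
  exact eLpNorm_const_smul c (fun y : ℝ => F ((x : ℝ) + y * Complex.I)) p lineMeasure

/-- Holomorphic functions on `ℂ⁺` of finite Hardy norm. A function on `ℂ⁺` is represented by its
extension by zero to `ℂ`, so that equality of elements is equality on `ℂ⁺`. -/
def hardySubmodule (p : ℝ≥0∞) [Fact (1 ≤ p)] : Submodule ℂ (ℂ → ℂ) where
  carrier := {F | DifferentiableOn ℂ F rightHalfPlane ∧ (∀ z ∉ rightHalfPlane, F z = 0) ∧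
    hardyNorm p F < ∞}
  zero_mem' := ⟨by simp, by simp, by simp [hardyNorm_zero]⟩
  add_mem' := by
    rintro F G ⟨hF, hF0, hFn⟩ ⟨hG, hG0, hGn⟩
    exact ⟨hF.add hG, fun z hz => by simp [hF0 z hz, hG0 z hz],
      (hardyNorm_add_le Fact.out hF hG).trans_lt (ENNReal.add_lt_top.2 ⟨hFn, hGn⟩)⟩
  smul_mem' := by
    rintro c F ⟨hF, hF0, hFn⟩
    exact ⟨hF.const_smul c, fun z hz => by simp [hF0 z hz], by
      rw [hardyNorm_smul]; exact ENNReal.mul_lt_top enorm_lt_top hFn⟩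

/-- The Hardy space `H_p(ℂ⁺)`, `1 ≤ p ≤ ∞`. -/
def Hardy (p : ℝ≥0∞) [Fact (1 ≤ p)] : Type := hardySubmodule p

namespace Hardy

variable {p : ℝ≥0∞} [Fact (1 ≤ p)]

instance : AddCommGroup (Hardy p) := inferInstanceAs (AddCommGroup (hardySubmodule p))
instance : Module ℂ (Hardy p) := inferInstanceAs (Module ℂ (hardySubmodule p))

/-- The underlying function of an element of `H_p(ℂ⁺)`. -/
def toFun (F : Hardy p) : ℂ → ℂ := Subtype.val F

instance : CoeFun (Hardy p) (fun _ => ℂ → ℂ) := ⟨toFun⟩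

lemma differentiableOn (F : Hardy p) : DifferentiableOn ℂ F rightHalfPlane := F.2.1
lemma apply_eq_zero (F : Hardy p) {z : ℂ} (hz : z ∉ rightHalfPlane) : F z = 0 := F.2.2.1 z hz
lemma hardyNorm_lt_top (F : Hardy p) : hardyNorm p F < ∞ := F.2.2.2

lemma coe_zero : ((0 : Hardy p) : ℂ → ℂ) = 0 := rfl
lemma coe_add (F G : Hardy p) : ((F + G : Hardy p) : ℂ → ℂ) = F + G := rfl
lemma coe_sub (F G : Hardy p) : ((F - G : Hardy p) : ℂ → ℂ) = F - G := rfl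
lemma coe_smul (c : ℂ) (F : Hardy p) : ((c • F : Hardy p) : ℂ → ℂ) = c • (F : ℂ → ℂ) := rfl

lemma ext {F G : Hardy p} (h : (F : ℂ → ℂ) = G) : F = G := Subtype.ext h

instance : Norm (Hardy p) := ⟨fun F => (hardyNorm p F).toReal⟩

lemma norm_def (F : Hardy p) : ‖F‖ = (hardyNorm p F).toReal := rfl

lemma eq_zero_of_hardyNorm_eq_zero (F : Hardy p) (h : hardyNorm p F = 0) : F = 0 := by
  refine ext (funext fun z => ?_)
  by_cases hz : z ∈ rightHalfPlane
  · have h0 : eLpNorm (fun y : ℝ => F (z.re + y * Complex.I)) p lineMeasure = 0 :=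
      le_antisymm ((eLpNorm_slice_le p F hz).trans h.le) bot_le
    have hc := continuous_slice F.differentiableOn hz
    rw [eLpNorm_eq_zero_iff hc.aestronglyMeasurable
      (zero_lt_one.trans_le (Fact.out : 1 ≤ p)).ne'] at h0
    have h1 : (fun y : ℝ => F (z.re + y * Complex.I)) =ᵐ[volume] 0 := by
      have hne : ENNReal.ofReal (1 / (2 * Real.pi)) ≠ 0 := by
        simp [Real.pi_pos]
      unfold lineMeasure at h0
      exact (Measure.ae_ennreal_smul_measure_iff hne).1 h0
    have h2 := (Continuous.ae_eq_iff_eq volume hc continuous_zero).1 h1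
    have := congrFun h2 z.im
    simpa [Complex.re_add_im, coe_zero] using this
  · rw [F.apply_eq_zero hz]; rfl

lemma core : NormedSpace.Core ℂ (Hardy p) where
  norm_nonneg _ := ENNReal.toReal_nonneg
  norm_smul c F := by
    rw [norm_def, coe_smul, hardyNorm_smul, ENNReal.toReal_mul, toReal_enorm, norm_def]
  norm_triangle F G := by
    rw [norm_def, norm_def, norm_def,
      ← ENNReal.toReal_add F.hardyNorm_lt_top.ne G.hardyNorm_lt_top.ne, coe_add]
    exact ENNReal.toReal_mono (ENNReal.add_lt_top.2 ⟨F.hardyNorm_lt_top, G.hardyNorm_lt_top⟩).ne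
      (hardyNorm_add_le Fact.out F.differentiableOn G.differentiableOn)
  norm_eq_zero_iff F := by
    constructor
    · intro h
      exact eq_zero_of_hardyNorm_eq_zero F
        (((ENNReal.toReal_eq_zero_iff _).1 h).resolve_right F.hardyNorm_lt_top.ne)
    · rintro rfl
      rw [norm_def, coe_zero, hardyNorm_zero, ENNReal.toReal_zero]

instance : NormedAddCommGroup (Hardy p) := NormedAddCommGroup.ofCore core
instance : NormedSpace ℂ (Hardy p) := NormedSpace.ofCore core

lemma measurable (F : Hardy p) : Measurable (F : ℂ → ℂ) := by
  classical
  have : (F : ℂ → ℂ) = rightHalfPlane.indicator F := by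
    ext z
    by_cases hz : z ∈ rightHalfPlane
    · simp [hz]
    · simp [hz, F.apply_eq_zero hz]
  rw [this]
  exact F.differentiableOn.continuousOn.measurable_piecewise continuousOn_const
    isOpen_rightHalfPlane.measurableSet

lemma dilation_mem (t : ℝ) (F : Hardy p) :
    (fun z : ℂ => (Real.exp (-(t * (p⁻¹).toReal)) : ℂ) * F (Real.exp (-t) * z)) ∈
      hardySubmodule p := by
  have hpos := Real.exp_pos (-t)
  have hmem : ∀ z : ℂ, (Real.exp (-t) : ℂ) * z ∈ rightHalfPlane ↔ z ∈ rightHalfPlane := by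
    intro z
    simp only [rightHalfPlane, mem_ofPred_eq, Complex.re_ofReal_mul]
    exact mul_pos_iff_of_pos_left hpos
  refine ⟨?_, fun z hz => ?_, ?_⟩
  · refine DifferentiableOn.const_mul ?_ _
    exact F.differentiableOn.comp (by fun_prop) fun z hz => (hmem z).2 hz
  · simp only
    rw [F.apply_eq_zero (fun h => hz ((hmem z).1 h)), mul_zero]
  · change hardyNorm p ((Real.exp (-(t * (p⁻¹).toReal)) : ℂ) •
      (fun z : ℂ => F (Real.exp (-t) * z))) < ∞
    rw [hardyNorm_smul]
    refine ENNReal.mul_lt_top enorm_lt_top ?_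
    set a := Real.exp (-t)
    set C : ℝ≥0∞ := (ENNReal.ofReal |a⁻¹|) ^ (1 / p).toReal with hC
    have hCt : C < ∞ := ENNReal.rpow_lt_top_of_nonneg ENNReal.toReal_nonneg ENNReal.ofReal_ne_top
    refine (iSup_le fun ⟨x, hx⟩ => ?_).trans_lt (ENNReal.mul_lt_top hCt F.hardyNorm_lt_top)
    have hax : 0 < a * x := mul_pos hpos hx
    have hmap : Measure.map (a * ·) lineMeasure = ENNReal.ofReal |a⁻¹| • lineMeasure := by
      unfold lineMeasure
      rw [Measure.map_smul, Real.map_volume_mul_left hpos.ne', smul_comm]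
    have hcont := continuous_slice F.differentiableOn hax
    have : (fun y : ℝ => F (a * (x + y * Complex.I))) =
        (fun y : ℝ => F ((a * x : ℝ) + y * Complex.I)) ∘ (a * ·) := by
      ext y; simp only [Function.comp]; congr 1; push_cast; ring
    simp only
    rw [this, ← eLpNorm_map_measure hcont.aestronglyMeasurable (by fun_prop), hmap]
    refine (eLpNorm_smul_measure_le _ _ _ _).trans ?_
    rw [smul_eq_mul]
    gcongr
    exact eLpNorm_slice_le p F hax


lemma two_pi_mul_enorm_le (F : Hardy p) {z : ℂ} {s r : ℝ} (hs : 0 < s) (hsr : s < r)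
    (hz : r < z.re) :
    ENNReal.ofReal (2 * Real.pi) * ‖F z‖ₑ ≤
      ∫⁻ θ in Ioo (-Real.pi) Real.pi,
        ‖F (z + s * (Real.cos θ + Real.sin θ * Complex.I))‖ₑ := by
  have hsub : Metric.closedBall z |s| ⊆ rightHalfPlane := by
    intro w hw
    rw [abs_of_pos hs, Metric.mem_closedBall, Complex.dist_eq] at hw
    have h1 := (abs_le.1 ((Complex.abs_re_le_norm (w - z)).trans hw)).1
    rw [Complex.sub_re] at h1
    change 0 < w.re
    linarith
  have hd : DiffContOnCl ℂ F (Metric.ball z |s|) := by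
    refine DifferentiableOn.diffContOnCl (F.differentiableOn.mono ?_)
    exact Metric.closure_ball_subset_closedBall.trans hsub
  have h := hd.circleAverage
  rw [Real.circleAverage_eq_integral_add (-Real.pi)] at h
  have h2 : (2 * Real.pi : ℝ) • F z =
      ∫ θ in Ioo (-Real.pi) Real.pi, F (z + s * (Real.cos θ + Real.sin θ * Complex.I)) := by
    rw [← h, smul_smul, mul_inv_cancel₀ (by positivity), one_smul,
      intervalIntegral.integral_comp_add_right (fun θ => F (circleMap z s θ)),
      intervalIntegral.integral_of_le (by linarith [Real.pi_pos]),
      integral_Ioc_eq_integral_Ioo]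
    have e1 : (0 : ℝ) + -Real.pi = -Real.pi := by ring
    have e2 : 2 * Real.pi + -Real.pi = Real.pi := by ring
    rw [e1, e2]
    congr 1
    ext θ
    rw [circleMap, Complex.exp_mul_I]
    push_cast
    rfl
  calc ENNReal.ofReal (2 * Real.pi) * ‖F z‖ₑ = ‖(2 * Real.pi : ℝ) • F z‖ₑ := by
        rw [enorm_smul, Real.enorm_of_nonneg (by positivity)]
    _ ≤ _ := by rw [h2]; exact enorm_integral_le_lintegral_enorm _

/-- Point evaluations on `H_p(ℂ⁺)` are bounded, uniformly away from the boundary. -/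
lemma exists_enorm_apply_le (p : ℝ≥0∞) [Fact (1 ≤ p)] {r : ℝ} (hr : 0 < r) :
    ∃ C : ℝ≥0∞, C < ∞ ∧ ∀ (F : Hardy p) (z : ℂ), r < z.re → ‖F z‖ₑ ≤ C * hardyNorm p F := by
  set V : ℝ≥0∞ := volume (Ioo (-r) r) with hV
  have hVt : V < ∞ := measure_Ioo_lt_top
  set A : ℝ≥0∞ := (ENNReal.ofReal (2 * Real.pi)) ^ (1 / p).toReal with hA
  have hAt : A < ∞ := ENNReal.rpow_lt_top_of_nonneg ENNReal.toReal_nonneg ENNReal.ofReal_ne_top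
  set B : ℝ≥0∞ := V ^ (1 / (1 : ℝ≥0∞).toReal - 1 / p.toReal) with hB
  have hV0 : V ≠ 0 := by
    rw [hV, Real.volume_Ioo]; simp; linarith
  have hBt : B < ∞ := (ENNReal.rpow_ne_top_of_ne_zero hV0 hVt.ne).lt_top
  set K : ℝ≥0∞ := ENNReal.ofReal (r / 2) * volume (Ioo (r / 2) r) *
    ENNReal.ofReal (2 * Real.pi) with hK
  have hK0 : K ≠ 0 := by
    rw [hK, Real.volume_Ioo]
    simp [Real.pi_pos, hr]
  have hKt : K ≠ ∞ := by
    rw [hK, Real.volume_Ioo]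
    exact ENNReal.mul_ne_top (ENNReal.mul_ne_top ENNReal.ofReal_ne_top ENNReal.ofReal_ne_top)
      ENNReal.ofReal_ne_top
  refine ⟨K⁻¹ * (V * (A * B)), ENNReal.mul_lt_top (ENNReal.inv_lt_top.2 (pos_iff_ne_zero.2 hK0))
    (ENNReal.mul_lt_top hVt (ENNReal.mul_lt_top hAt hBt)), fun F z hz => ?_⟩
  rw [mul_assoc, ← ENNReal.mul_le_iff_le_inv hK0 hKt]
  have hFm := F.measurable
  -- the area integral
  set g : ℂ → ℝ≥0∞ := (Metric.ball (0 : ℂ) r).indicator (fun w => ‖F (z + w)‖ₑ) with hg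
  have hgm : Measurable g :=
    Measurable.indicator (by fun_prop) Metric.isOpen_ball.measurableSet
  have lower : K * ‖F z‖ₑ ≤ ∫⁻ w, g w := by
    rw [← Complex.lintegral_comp_polarCoord_symm g, polarCoord_target]
    have hm : Measurable fun q : ℝ × ℝ => ENNReal.ofReal q.1 • g (Complex.polarCoord.symm q) := by
      simp only [Complex.polarCoord_symm_apply, smul_eq_mul]
      fun_prop
    rw [Measure.volume_eq_prod, setLIntegral_prod _ hm.aemeasurable]
    calc K * ‖F z‖ₑ = ∫⁻ s in Ioo (r / 2) r,
          ENNReal.ofReal (r / 2) * (ENNReal.ofReal (2 * Real.pi) * ‖F z‖ₑ) := by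
          rw [setLIntegral_const, hK]; ring
      _ ≤ ∫⁻ s in Ioo (r / 2) r, ∫⁻ θ in Ioo (-Real.pi) Real.pi,
          ENNReal.ofReal s • g (Complex.polarCoord.symm (s, θ)) := by
          refine setLIntegral_mono' measurableSet_Ioo fun s hs => ?_
          have hs0 : 0 < s := by linarith [hs.1]
          simp only [smul_eq_mul]
          rw [lintegral_const_mul' _ _ ENNReal.ofReal_ne_top]
          refine mul_le_mul' (ENNReal.ofReal_le_ofReal hs.1.le) ?_
          refine (two_pi_mul_enorm_le F hs0 hs.2 hz).trans (le_of_eq ?_)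
          refine lintegral_congr fun θ => ?_
          rw [hg, indicator_of_mem, Complex.polarCoord_symm_apply]
          rw [Metric.mem_ball, dist_zero_right, Complex.norm_polarCoord_symm, abs_of_pos hs0]
          exact hs.2
      _ ≤ _ := by
          refine lintegral_mono_set fun s hs => ?_
          exact lt_trans (by linarith) hs.1
  refine lower.trans ?_
  rw [← (Complex.volume_preserving_equiv_real_prod.symm).lintegral_comp hgm,
    Measure.volume_eq_prod, lintegral_prod _ (by fun_prop)]
  have inner : ∀ x ∈ Ioo (-r) r, ∫⁻ y in Ioo (-r) r, ‖F (z + (x + y * Complex.I))‖ₑ ≤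
      A * hardyNorm p F * B := by
    intro x hx
    have hpos : 0 < z.re + x := by linarith [hx.1]
    set h : ℝ → ℂ := fun y => F ((z.re + x : ℝ) + y * Complex.I)
    have hcont : Continuous h := continuous_slice F.differentiableOn hpos
    have e : (fun y : ℝ => F (z + (x + y * Complex.I))) = h ∘ (z.im + ·) := by
      ext y
      simp only [h, Function.comp]
      congr 1
      apply Complex.ext <;> simp
    have hc2 : Continuous (h ∘ (z.im + ·)) := by fun_prop
    calc ∫⁻ y in Ioo (-r) r, ‖F (z + (x + y * Complex.I))‖ₑ
        = eLpNorm (h ∘ (z.im + ·)) 1 (volume.restrict (Ioo (-r) r)) := by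
          rw [← e, eLpNorm_one_eq_lintegral_enorm]
      _ ≤ eLpNorm (h ∘ (z.im + ·)) p (volume.restrict (Ioo (-r) r)) * B := by
          refine (eLpNorm_le_eLpNorm_mul_rpow_measure_univ (Fact.out : 1 ≤ p)
            hc2.aestronglyMeasurable).trans (le_of_eq ?_)
          rw [Measure.restrict_apply_univ]
      _ ≤ eLpNorm (h ∘ (z.im + ·)) p volume * B := by
          gcongr
          exact Measure.restrict_le_self
      _ = eLpNorm h p volume * B := by
          rw [eLpNorm_comp_measurePreserving hcont.aestronglyMeasurable
            (measurePreserving_add_left volume z.im)]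
      _ ≤ A * hardyNorm p F * B := by
          gcongr
          have hvol : (volume : Measure ℝ) = ENNReal.ofReal (2 * Real.pi) • lineMeasure := by
            unfold lineMeasure
            rw [smul_smul, ← ENNReal.ofReal_mul (by positivity),
              mul_one_div_cancel (by positivity), ENNReal.ofReal_one, one_smul]
          rw [hvol]
          refine (eLpNorm_smul_measure_le _ _ _ _).trans ?_
          rw [smul_eq_mul]
          gcongr
          exact eLpNorm_slice_le p F hpos
  have hsq : ∀ x y : ℝ, g (Complex.measurableEquivRealProd.symm (x, y)) ≤
      (Ioo (-r) r).indicator (fun x => (Ioo (-r) r).indicator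
        (fun y => ‖F (z + (x + y * Complex.I))‖ₑ) y) x := by
    intro x y
    have ew : Complex.measurableEquivRealProd.symm (x, y) = x + y * Complex.I := by
      rw [Complex.measurableEquivRealProd_symm_apply]
      apply Complex.ext <;> simp
    rw [ew, hg]
    by_cases hw : (x + y * Complex.I : ℂ) ∈ Metric.ball (0 : ℂ) r
    · have hn : ‖(x + y * Complex.I : ℂ)‖ < r := by simpa using hw
      have hx : x ∈ Ioo (-r) r := abs_lt.1 <| by
        simpa using (Complex.abs_re_le_norm (x + y * Complex.I : ℂ)).trans_lt hn
      have hy : y ∈ Ioo (-r) r := abs_lt.1 <| by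
        simpa using (Complex.abs_im_le_norm (x + y * Complex.I : ℂ)).trans_lt hn
      rw [indicator_of_mem hw, indicator_of_mem hx, indicator_of_mem hy]
    · rw [indicator_of_notMem hw]
      exact zero_le
  calc _ ≤ ∫⁻ x, ∫⁻ y, (Ioo (-r) r).indicator (fun x => (Ioo (-r) r).indicator
        (fun y => ‖F (z + (x + y * Complex.I))‖ₑ) y) x :=
        lintegral_mono fun x => lintegral_mono fun y => hsq x y
    _ = ∫⁻ x in Ioo (-r) r, ∫⁻ y in Ioo (-r) r, ‖F (z + (x + y * Complex.I))‖ₑ := by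
        rw [← lintegral_indicator measurableSet_Ioo]
        refine lintegral_congr fun x => ?_
        by_cases hx : x ∈ Ioo (-r) r
        · simp only [indicator_of_mem hx]
          rw [lintegral_indicator measurableSet_Ioo]
        · simp [indicator_of_notMem hx]
    _ ≤ ∫⁻ x in Ioo (-r) r, A * hardyNorm p F * B :=
        setLIntegral_mono' measurableSet_Ioo inner
    _ = V * (A * B) * hardyNorm p F := by
        rw [setLIntegral_const]; ring

instance : CompleteSpace (Hardy p) := by
  refine Metric.complete_of_cauchySeq_tendsto fun u hu => ?_
  have hlt : ∀ ε > 0, ∃ N, ∀ m ≥ N, ∀ n ≥ N,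
      hardyNorm p ((u m - u n : Hardy p) : ℂ → ℂ) < ENNReal.ofReal ε := by
    intro ε hε
    obtain ⟨N, hN⟩ := Metric.cauchySeq_iff.1 hu ε hε
    refine ⟨N, fun m hm n hn => ?_⟩
    have h := hN m hm n hn
    rw [dist_eq_norm, norm_def] at h
    exact (ENNReal.lt_ofReal_iff_toReal_lt (hardyNorm_lt_top _).ne).2 h
  have hunif : ∀ r > 0, UniformCauchySeqOn (fun n => (u n : ℂ → ℂ)) atTop {z | r < z.re} := by
    intro r hr
    obtain ⟨C, hC, hbound⟩ := exists_enorm_apply_le p hr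
    rw [Metric.uniformCauchySeqOn_iff]
    intro ε hε
    obtain ⟨N, hN⟩ := hlt (ε / (C.toReal + 1)) (by positivity)
    refine ⟨N, fun m hm n hn z hz => ?_⟩
    have h1 := hbound (u m - u n) z hz
    have h2 : ‖(u m - u n : Hardy p) z‖ ≤ C.toReal * (ε / (C.toReal + 1)) := by
      rw [← ENNReal.ofReal_le_ofReal_iff (by positivity), ofReal_norm,
        ENNReal.ofReal_mul ENNReal.toReal_nonneg, ENNReal.ofReal_toReal hC.ne]
      exact h1.trans (mul_le_mul_right (hN m hm n hn).le _)
    rw [dist_eq_norm]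
    refine lt_of_le_of_lt h2 ?_
    rw [mul_div_assoc', div_lt_iff₀ (by positivity)]
    nlinarith
  have hpt : ∀ z, ∃ a, Tendsto (fun n => (u n : ℂ → ℂ) z) atTop (𝓝 a) := by
    intro z
    by_cases hz : z ∈ rightHalfPlane
    · exact cauchySeq_tendsto_of_complete
        ((hunif (z.re / 2) (half_pos hz)).cauchySeq (half_lt_self (a := z.re) hz))
    · exact ⟨0, by simp [apply_eq_zero _ hz]⟩
  choose f hf using hpt
  have hfd : DifferentiableOn ℂ f rightHalfPlane := by
    intro z hz
    have ho : IsOpen {w : ℂ | z.re / 2 < w.re} := isOpen_lt continuous_const Complex.continuous_re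
    have hsub : {w : ℂ | z.re / 2 < w.re} ⊆ rightHalfPlane := fun w hw => by
      exact lt_trans (half_pos (a := z.re) hz) hw
    have h1 := ((hunif (z.re / 2) (half_pos hz)).tendstoUniformlyOn_of_tendsto
      fun w _ => hf w).tendstoLocallyUniformlyOn
    have h2 := h1.differentiableOn
      (Eventually.of_forall fun n => (u n).differentiableOn.mono hsub) ho
    exact (h2.differentiableAt (ho.mem_nhds (half_lt_self (a := z.re) hz))).differentiableWithinAt
  have hf0 : ∀ z ∉ rightHalfPlane, f z = 0 := fun z hz =>
    tendsto_nhds_unique (hf z) (by simp [apply_eq_zero _ hz])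
  have hclose : ∀ ε > 0, ∃ N, ∀ n ≥ N, hardyNorm p (f - u n) ≤ ENNReal.ofReal ε := by
    intro ε hε
    obtain ⟨N, hN⟩ := hlt ε hε
    refine ⟨N, fun n hn => iSup_le fun ⟨x, hx⟩ => ?_⟩
    refine (Lp.eLpNorm_lim_le_liminf_eLpNorm
      (f := fun m => fun y : ℝ => (u m - u n : Hardy p) (x + y * Complex.I))
      (fun m => (continuous_slice (u m - u n).differentiableOn hx).aestronglyMeasurable) _
      (Eventually.of_forall fun y => (hf _).sub tendsto_const_nhds)).trans ?_
    refine liminf_le_of_frequently_le' (Eventually.frequently ?_)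
    filter_upwards [eventually_ge_atTop N] with m hm
    exact (eLpNorm_slice_le p _ hx).trans (hN m hm n hn).le
  obtain ⟨N, hN⟩ := hclose 1 one_pos
  have hfin : hardyNorm p f < ∞ := by
    have e : f = (f - u N) + u N := by simp
    rw [e]
    exact (hardyNorm_add_le Fact.out (hfd.sub (u N).differentiableOn)
      (u N).differentiableOn).trans_lt (ENNReal.add_lt_top.2
        ⟨(hN N le_rfl).trans_lt ENNReal.ofReal_lt_top, (u N).hardyNorm_lt_top⟩)
  let L : Hardy p := ⟨f, hfd, hf0, hfin⟩
  refine ⟨L, Metric.tendsto_atTop.2 fun ε hε => ?_⟩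
  obtain ⟨N, hN⟩ := hclose (ε / 2) (half_pos hε)
  refine ⟨N, fun n hn => ?_⟩
  rw [dist_comm, dist_eq_norm, norm_def]
  exact (ENNReal.toReal_le_of_le_ofReal (half_pos hε).le (hN n hn)).trans_lt (half_lt_self hε)

/-- The group `T_p(t)` on `H_p(ℂ⁺)`: `T_p(t) F (z) = e^{-t/p} F(e^{-t} z)`, where `t/∞ = 0`. -/
def dilation (t : ℝ) (F : Hardy p) : Hardy p :=
  ⟨fun z : ℂ => (Real.exp (-(t * (p⁻¹).toReal)) : ℂ) * F (Real.exp (-t) * z), dilation_mem t F⟩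

end Hardy

/-- The subordination kernel `φ_{α,p}(t) = α (1 - e^{-t})^{α-1} e^{-t/p}`. -/
def kernel (α : ℝ) (p : ℝ≥0∞) (t : ℝ) : ℝ :=
  α * (1 - Real.exp (-t)) ^ (α - 1) * Real.exp (-(t * (p⁻¹).toReal))

/-- The `H_q`-valued function `t ↦ φ_{α,p}(t) T_q(t) G`, where `1/p + 1/q = 1`. -/
def complexCesaroIntegrand (α : ℝ) {q : ℝ≥0∞} [Fact (1 ≤ q)] (G : Hardy q) (t : ℝ) : Hardy q :=
  kernel α q.conjExponent t • Hardy.dilation t G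

/-- The complex Cesàro–Hardy operator `𝔠_α G = ∫₀^∞ φ_{α,p}(t) T_q(t) G dt` on `H_q(ℂ⁺)`,
`1/p + 1/q = 1`: a Bochner integral in `H_q(ℂ⁺)`. -/
def complexCesaro (α : ℝ) {q : ℝ≥0∞} [Fact (1 ≤ q)] (G : Hardy q) : Hardy q :=
  ∫ t, complexCesaroIntegrand α G t ∂halfLine

/-- The `H_p`-valued function `t ↦ φ_{α,p}(t) T_p(-t) F`. -/
def complexCesaroStarIntegrand (α : ℝ) {p : ℝ≥0∞} [Fact (1 ≤ p)] (F : Hardy p) (t : ℝ) :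
    Hardy p :=
  kernel α p t • Hardy.dilation (-t) F

/-- The complex Cesàro–Hardy operator `𝔠*_α F = ∫₀^∞ φ_{α,p}(t) T_p(-t) F dt` on `H_p(ℂ⁺)`:
a Bochner integral in `H_p(ℂ⁺)`. -/
def complexCesaroStar (α : ℝ) {p : ℝ≥0∞} [Fact (1 ≤ p)] (F : Hardy p) : Hardy p :=
  ∫ t, complexCesaroStarIntegrand α F t ∂halfLine

/-- Membership in `𝒜₀(ℂ⁺)`: `F` is holomorphic on `ℂ⁺` and has a continuous extension to the
closed half-plane that tends to zero at infinity there. -/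
def IsA0 (F : ℂ → ℂ) : Prop :=
  DifferentiableOn ℂ F rightHalfPlane ∧
    ∃ g : ℂ → ℂ, EqOn g F rightHalfPlane ∧ ContinuousOn g {z | 0 ≤ z.re} ∧
      Tendsto g (cocompact ℂ ⊓ 𝓟 {z | 0 ≤ z.re}) (𝓝 0)

/-- The integrand `u ↦ (s - u)^{α-1} f(u)` of the real Cesàro–Hardy operator `𝒞_α` at `s`. -/
def cesaroIntegrand (α : ℝ) (f : ℝ → ℂ) (s u : ℝ) : ℂ :=
  ((s - u) ^ (α - 1) : ℝ) * f u

/-- `𝒞_α f (s) = (α / s^α) ∫₀^s (s - u)^{α-1} f(u) du`. -/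
def cesaro (α : ℝ) (f : ℝ → ℂ) (s : ℝ) : ℂ :=
  (α / s ^ α : ℝ) * ∫ u in Ioo 0 s, cesaroIntegrand α f s u

/-- The integrand `u ↦ (u - s)^{α-1} u^{-α} f(u)` of the real operator `𝒞*_α` at `s`. -/
def cesaroStarIntegrand (α : ℝ) (f : ℝ → ℂ) (s u : ℝ) : ℂ :=
  ((u - s) ^ (α - 1) / u ^ α : ℝ) * f u

/-- `𝒞*_α f (s) = α ∫_s^∞ (u - s)^{α-1} u^{-α} f(u) du`. -/
def cesaroStar (α : ℝ) (f : ℝ → ℂ) (s : ℝ) : ℂ :=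
  α * ∫ u in Ioi s, cesaroStarIntegrand α f s u

/-- The Laplace transform `ℒ f (z) = ∫₀^∞ e^{-zt} f(t) dt`. -/
def laplace (f : ℝ → ℂ) (z : ℂ) : ℂ :=
  ∫ t, Complex.exp (-(z * t)) * f t ∂halfLine

/-- On `ℂ⁺`, the Laplace integral of `f` converges absolutely and `ℒ f = F`. -/
def HasLaplaceTransform (f : ℝ → ℂ) (F : ℂ → ℂ) : Prop :=
  ∀ z ∈ rightHalfPlane,
    Integrable (fun t : ℝ => Complex.exp (-(z * t)) * f t) halfLine ∧ laplace f z = F z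

end CesaroHardy
end

open CesaroHardy

/-! ### Plancherel's identity for the Fourier integral. -/

namespace CesaroHardy

open scoped FourierTransform SchwartzMap

/-! Both real operators are averages of a dilation group. Let `D_t f(s) = e^{t/r} f(e^t s)`, a group
of isometries of `L_r(ℝ⁺)`. The substitution `u = e^t s` turns `𝒞*_α f` into `∫ φ_{α,p}(t) D_t f dt`
with `r = p`, and `u = e^{-t} s` turns `𝒞_α f` into `∫ φ_{α,p}(t) D_{-t} f dt` with `r = q`
(`cesaroStar_eq_subordinated`, `cesaro_eq_subordinated`). A change of variable in the Laplace
integral carries `D_t` on `L_p` to `T_q(t)` on `H_q` (`dilation_laplaceHardy`), so `ℒ` must carry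
each average to the matching average of the complex group.

Three facts make this rigorous. The kernel is integrable, being a Beta integral in the variable
`e^{-t}` (`integrable_kernel`). With Minkowski's inequality this gives almost everywhere convergence
and membership in `L_r` (`lintegral_subordinated_rpow_lt_top`). The Laplace transform is bounded
from `L_p` to `H_q` for `p ≤ 2`: its restriction to a vertical line is a Fourier transform, so this
is Hausdorff–Young (`exists_eLpNorm_fourier_le`), obtained by interpolating between `L¹ → L^∞` and
Plancherel. Boundedness transports continuity of the real orbits to `t ↦ T_q(t) ℒf`, so the complex
integral is a Bochner integral. Point evaluations are continuous on `H_q`, and the identity then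
follows at each point from Fubini (`laplace_subordinated`).

For `p = 1`, membership in `𝒜₀` is the Riemann–Lebesgue lemma on the closed half-plane
(`tendsto_laplace_cocompact`). -/

lemma integral_fourier_mul_eq {f g : ℝ → ℂ} (hf : Integrable f) (hg : Integrable g) :
    ∫ x, 𝓕 f x * g x = ∫ x, f x * 𝓕 g x := by
  have h := VectorFourier.integral_fourierIntegral_smul_eq_flip (L := innerₗ ℝ)
    Real.continuous_fourierChar continuous_inner hf hg
  simpa using! h

lemma continuous_fourier {f : ℝ → ℂ} (hf : Integrable f) : Continuous (𝓕 f) :=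
  VectorFourier.fourierIntegral_continuous Real.continuous_fourierChar continuous_inner hf

/-- Plancherel's theorem for the Fourier integral of a function in `L¹ ∩ L²`. -/
lemma eLpNorm_fourier_two {f : ℝ → ℂ} (hf : Integrable f) (hf2 : MemLp f 2) :
    eLpNorm (𝓕 f) 2 volume = eLpNorm f 2 volume := by
  set G : Lp ℂ 2 (volume : Measure ℝ) := hf2.toLp f with hG
  -- The Fourier integral and the `L²` extension agree as distributions: against a smooth compactly
  -- supported test function, the multiplication formula moves `𝓕` onto the test function in both
  -- pairings.
  have hae : ∀ᵐ x, 𝓕 f x = (𝓕 G : Lp ℂ 2 (volume : Measure ℝ)) x := by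
    refine ae_eq_of_integral_contDiff_smul_eq (continuous_fourier hf).locallyIntegrable
      ((Lp.memLp _).locallyIntegrable (by norm_num)) fun g hg hgc => ?_
    have hgc' : HasCompactSupport fun x => (g x : ℂ) := hgc.comp_left Complex.ofReal_zero
    have hg' : ContDiff ℝ (⊤ : ℕ∞) fun x => (g x : ℂ) := Complex.ofRealCLM.contDiff.comp hg
    set φ : 𝓢(ℝ, ℂ) := hgc'.toSchwartzMap hg' with hφ
    have h1 := congrArg (fun T => T φ) (Lp.fourier_toTemperedDistribution_eq G)
    simp only [TemperedDistribution.fourier_apply, Lp.toTemperedDistribution_apply] at h1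
    have h2 := integral_fourier_mul_eq φ.integrable hf
    rw [SchwartzMap.fourier_coe] at h1
    calc ∫ x, g x • 𝓕 f x = ∫ x, φ x * 𝓕 f x := by
          refine integral_congr_ae (Eventually.of_forall fun x => ?_)
          simp [hφ]
      _ = ∫ x, 𝓕 φ x * f x := h2.symm
      _ = ∫ x, 𝓕 φ x • G x := by
          refine integral_congr_ae ?_
          filter_upwards [hf2.coeFn_toLp] with x hx
          rw [hG, hx, smul_eq_mul]
      _ = ∫ x, φ x • (𝓕 G : Lp ℂ 2 (volume : Measure ℝ)) x := h1
      _ = _ := by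
          refine integral_congr_ae (Eventually.of_forall fun x => ?_)
          simp [hφ]
  rw [eLpNorm_congr_ae hae, ← eLpNorm_congr_ae hf2.coeFn_toLp]
  have h := Lp.norm_fourier_eq G
  rw [Lp.norm_def, Lp.norm_def] at h
  exact (ENNReal.toReal_eq_toReal_iff' (Lp.eLpNorm_ne_top _) (Lp.eLpNorm_ne_top _)).1 h

lemma eLpNorm_fourier_two_le {f : ℝ → ℂ} (hf : Integrable f) :
    eLpNorm (𝓕 f) 2 volume ≤ eLpNorm f 2 volume := by
  by_cases h : eLpNorm f 2 volume = ∞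
  · rw [h]; exact le_top
  · exact (eLpNorm_fourier_two hf ⟨hf.1, lt_top_iff_ne_top.2 h⟩).le

lemma enorm_fourier_le (f : ℝ → ℂ) (w : ℝ) : ‖𝓕 f w‖ₑ ≤ ∫⁻ x, ‖f x‖ₑ := by
  rw [Real.fourier_eq]
  refine (enorm_integral_le_lintegral_enorm _).trans (le_of_eq ?_)
  refine lintegral_congr fun x => ?_
  rw [← ofReal_norm, Circle.norm_smul, ofReal_norm]

lemma lintegral_enorm_fourier_sq_le {f : ℝ → ℂ} (hf : Integrable f) :
    ∫⁻ w, ‖𝓕 f w‖ₑ ^ 2 ≤ ∫⁻ x, ‖f x‖ₑ ^ 2 := by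
  have h := eLpNorm_fourier_two_le hf
  rw [eLpNorm_eq_lintegral_rpow_enorm_toReal (by norm_num) (by norm_num),
    eLpNorm_eq_lintegral_rpow_enorm_toReal (by norm_num) (by norm_num)] at h
  simpa using (ENNReal.rpow_le_rpow_iff (by norm_num)).1 h

end CesaroHardy

/-! ### The Hausdorff–Young inequality by real interpolation. -/

namespace CesaroHardy

open scoped FourierTransform

/-- Split `f` at a height depending on `t`. Where `t |f|^{p-1} > 2` one has `|f| ≤ (t/2) |f|^p`, so
this part has `L¹` norm, hence Fourier transform, at most `t/2`. The other part must therefore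
exceed `t/2` in frequency, and Chebyshev with Plancherel bounds how often. Cutting at a power of
`|f|` matched to the normalisation `∫ |f|^p ≤ 1` yields a strong-type bound directly after
integration in `t`. -/
lemma meas_lt_norm_fourier_le {p t : ℝ} (ht : 0 < t) {f : ℝ → ℂ} (hf : Integrable f)
    (hfm : Measurable f) (h1 : ∫⁻ x, ‖f x‖ₑ ^ p ≤ 1) :
    volume {w | t < ‖𝓕 f w‖} ≤ ENNReal.ofReal (4 / t ^ 2) *
      ∫⁻ x, {x | t * ‖f x‖ ^ (p - 1) ≤ 2}.indicator (fun x => ‖f x‖ₑ ^ 2) x := by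
  set S : Set ℝ := {x | t * ‖f x‖ ^ (p - 1) ≤ 2} with hS
  have hSm : MeasurableSet S := measurableSet_le (by fun_prop) measurable_const
  have hi1 : Integrable (Sᶜ.indicator f) := hf.indicator hSm.compl
  have hi2 : Integrable (S.indicator f) := hf.indicator hSm
  have hlarge : ∀ w, ‖𝓕 (Sᶜ.indicator f) w‖ₑ ≤ ENNReal.ofReal (t / 2) := by
    intro w
    refine (enorm_fourier_le _ w).trans ?_
    calc ∫⁻ x, ‖Sᶜ.indicator f x‖ₑ ≤ ∫⁻ x, ENNReal.ofReal (t / 2) * ‖f x‖ₑ ^ p := by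
          refine lintegral_mono fun x => ?_
          by_cases hx : x ∈ S
          · simp [hx]
          · rw [indicator_of_mem (by exact hx)]
            have hx' : 2 < t * ‖f x‖ ^ (p - 1) := not_le.1 hx
            have h0 : f x ≠ 0 ∨ f x = 0 := ne_or_eq _ _
            rcases h0 with h0 | h0
            · have hpos : 0 < ‖f x‖ := norm_pos_iff.2 h0
              rw [← ofReal_norm, ENNReal.ofReal_rpow_of_pos hpos,
                ← ENNReal.ofReal_mul (by positivity)]
              refine ENNReal.ofReal_le_ofReal ?_
              have e : ‖f x‖ ^ p = ‖f x‖ ^ (p - 1) * ‖f x‖ := by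
                rw [Real.rpow_sub_one hpos.ne']; field_simp
              rw [e]
              nlinarith
            · simp [h0]
      _ = ENNReal.ofReal (t / 2) * ∫⁻ x, ‖f x‖ₑ ^ p :=
          lintegral_const_mul' _ _ ENNReal.ofReal_ne_top
      _ ≤ ENNReal.ofReal (t / 2) := mul_le_of_le_one_right' h1
  have hadd : ∀ w, 𝓕 f w = 𝓕 (Sᶜ.indicator f) w + 𝓕 (S.indicator f) w := by
    intro w
    have e : f = Sᶜ.indicator f + S.indicator f := by
      rw [add_comm]; exact (indicator_self_add_compl S f).symm
    conv_lhs => rw [e]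
    exact congrFun (VectorFourier.fourierIntegral_add Real.continuous_fourierChar
      continuous_inner hi1 hi2) w
  have hsub : {w | t < ‖𝓕 f w‖} ⊆
      {w | ENNReal.ofReal (t / 2) ^ 2 ≤ ‖𝓕 (S.indicator f) w‖ₑ ^ 2} := by
    intro w hw
    have h2 := hlarge w
    rw [← ofReal_norm, ENNReal.ofReal_le_ofReal_iff (by positivity)] at h2
    have h3 : t < ‖𝓕 f w‖ := hw
    rw [hadd w] at h3
    have h4 := norm_add_le (𝓕 (Sᶜ.indicator f) w) (𝓕 (S.indicator f) w)
    change ENNReal.ofReal (t / 2) ^ 2 ≤ ‖𝓕 (S.indicator f) w‖ₑ ^ 2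
    gcongr
    rw [← ofReal_norm]
    exact ENNReal.ofReal_le_ofReal (by linarith)
  have hcheb := mul_meas_ge_le_lintegral₀ (μ := volume)
    (f := fun w => ‖𝓕 (S.indicator f) w‖ₑ ^ 2)
    ((continuous_fourier hi2).measurable.enorm.pow_const 2).aemeasurable
    (ENNReal.ofReal (t / 2) ^ 2)
  have hpos : ENNReal.ofReal (t / 2) ^ 2 ≠ 0 := by
    simp [ht]
  have e4 : ENNReal.ofReal (4 / t ^ 2) = (ENNReal.ofReal (t / 2) ^ 2)⁻¹ := by
    rw [← ENNReal.ofReal_pow (by positivity), ← ENNReal.ofReal_inv_of_pos (by positivity)]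
    congr 1
    field_simp
    norm_num
  rw [e4, ← ENNReal.mul_le_iff_le_inv hpos (by simp)]
  refine (mul_le_mul_right (measure_mono hsub) _).trans (hcheb.trans ?_)
  refine (lintegral_enorm_fourier_sq_le hi2).trans (le_of_eq ?_)
  refine lintegral_congr fun x => ?_
  by_cases hx : x ∈ S <;> simp [hx]

lemma lintegral_Ioc_rpow {r T : ℝ} (hr : -1 < r) (hT : 0 ≤ T) :
    ∫⁻ t in Ioc 0 T, ENNReal.ofReal (t ^ r) = ENNReal.ofReal (T ^ (r + 1) / (r + 1)) := by
  have hi := (intervalIntegral.intervalIntegrable_rpow' hr (a := 0) (b := T))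
  rw [intervalIntegrable_iff_integrableOn_Ioc_of_le hT] at hi
  rw [← ofReal_integral_eq_lintegral_ofReal hi, ← intervalIntegral.integral_of_le hT,
    integral_rpow (Or.inl hr), Real.zero_rpow (by linarith), sub_zero]
  filter_upwards [self_mem_ae_restrict measurableSet_Ioc] with t ht
  exact Real.rpow_nonneg ht.1.le _

/-- Insert the distribution estimate into the layer-cake formula and exchange the integrals. For
fixed `x` the `t`-integral of `4 t^{q-3}` runs over `t ≤ 2 / |f x|^{p-1}` and converges at `0`
because `p < 2` forces `q > 2`. -/
lemma lintegral_enorm_fourier_rpow_le_of_le_one {p q : ℝ} (hp : p < 2)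
    (hpq : p.HolderConjugate q) {f : ℝ → ℂ} (hf : Integrable f)
    (hfm : Measurable f) (h1 : ∫⁻ x, ‖f x‖ₑ ^ p ≤ 1) :
    ∫⁻ w, ‖𝓕 f w‖ₑ ^ q ≤ ENNReal.ofReal (q * (4 * (2 ^ (q - 2) / (q - 2)))) := by
  have hq0 : 0 < q := hpq.symm.pos
  have hp1 : 1 < p := hpq.lt
  have hmul : p * q = p + q := hpq.mul_eq_add
  have hq2 : 2 < q := by nlinarith
  have hcont := continuous_fourier hf
  set Φ : ℝ × ℝ → ℝ≥0∞ := {y : ℝ × ℝ | y.1 * ‖f y.2‖ ^ (p - 1) ≤ 2}.indicator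
    (fun y => ENNReal.ofReal (4 * y.1 ^ (q - 3)) * ‖f y.2‖ₑ ^ 2) with hΦ
  have hΦm : Measurable Φ :=
    Measurable.indicator (by fun_prop) (measurableSet_le (by fun_prop) measurable_const)
  have inner : ∀ x, ∫⁻ t in Ioi 0, Φ (t, x) ≤
      ENNReal.ofReal (4 * (2 ^ (q - 2) / (q - 2))) * ‖f x‖ₑ ^ p := by
    intro x
    by_cases h0 : f x = 0
    · simp [hΦ, h0, indicator]
    have ha : 0 < ‖f x‖ := norm_pos_iff.2 h0
    set a := ‖f x‖
    have hap : 0 < a ^ (p - 1) := Real.rpow_pos_of_pos ha _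
    set T := 2 / a ^ (p - 1) with hT
    have hT0 : 0 ≤ T := by positivity
    calc ∫⁻ t in Ioi 0, Φ (t, x)
        = ∫⁻ t in Ioi 0, (Iic T).indicator
            (fun t => ENNReal.ofReal (4 * t ^ (q - 3)) * ‖f x‖ₑ ^ 2) t := by
          refine lintegral_congr fun t => ?_
          have : ((t, x) ∈ {y : ℝ × ℝ | y.1 * ‖f y.2‖ ^ (p - 1) ≤ 2}) ↔ t ∈ Iic T := by
            change t * a ^ (p - 1) ≤ 2 ↔ t ≤ T
            rw [hT, le_div_iff₀ hap]
          by_cases ht : t ∈ Iic T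
          · rw [indicator_of_mem ht, hΦ, indicator_of_mem (this.2 ht)]
          · rw [indicator_of_notMem ht, hΦ, indicator_of_notMem (mt this.1 ht)]
      _ = ∫⁻ t in Ioc 0 T, ENNReal.ofReal 4 * ‖f x‖ₑ ^ 2 * ENNReal.ofReal (t ^ (q - 3)) := by
          rw [lintegral_indicator measurableSet_Iic, Measure.restrict_restrict measurableSet_Iic,
            inter_comm, Ioi_inter_Iic]
          refine lintegral_congr fun t => ?_
          rw [ENNReal.ofReal_mul (by norm_num)]
          ring
      _ = ENNReal.ofReal 4 * ‖f x‖ₑ ^ 2 * ENNReal.ofReal (T ^ (q - 2) / (q - 2)) := by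
          rw [lintegral_const_mul _ (by fun_prop), lintegral_Ioc_rpow (by linarith) hT0,
            show q - 3 + 1 = q - 2 by ring]
      _ ≤ _ := by
          refine le_of_eq ?_
          rw [← ofReal_norm, ENNReal.ofReal_rpow_of_pos ha, ← ENNReal.ofReal_pow ha.le,
            ← ENNReal.ofReal_mul (by norm_num), ← ENNReal.ofReal_mul (by positivity),
            ← ENNReal.ofReal_mul (mul_nonneg (by norm_num)
              (div_nonneg (by positivity) (by linarith)))]
          congr 1
          change 4 * a ^ 2 * (T ^ (q - 2) / (q - 2)) = 4 * (2 ^ (q - 2) / (q - 2)) * a ^ p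
          -- The exponent of `a` is `2 - (p - 1)(q - 2)`, which equals `p` since `p q = p + q`.
          have e : a ^ 2 * T ^ (q - 2) = 2 ^ (q - 2) * a ^ p := by
            rw [hT, Real.div_rpow (by norm_num) hap.le, ← Real.rpow_mul ha.le,
              mul_div_assoc', div_eq_iff (Real.rpow_pos_of_pos ha _).ne', mul_assoc,
              ← Real.rpow_add ha, mul_comm, ← Real.rpow_natCast]
            congr 2
            push_cast
            linarith
          linear_combination 4 / (q - 2) * e
  calc ∫⁻ w, ‖𝓕 f w‖ₑ ^ q = ∫⁻ w, ENNReal.ofReal (‖𝓕 f w‖ ^ q) := by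
        refine lintegral_congr fun w => ?_
        rw [← ofReal_norm, ENNReal.ofReal_rpow_of_nonneg (norm_nonneg _) hq0.le]
    _ = ENNReal.ofReal q * ∫⁻ t in Ioi 0, volume {w | t < ‖𝓕 f w‖} *
          ENNReal.ofReal (t ^ (q - 1)) :=
        lintegral_rpow_eq_lintegral_meas_lt_mul volume
          (Eventually.of_forall fun w => norm_nonneg _) hcont.norm.measurable.aemeasurable hq0
    _ ≤ ENNReal.ofReal q * ∫⁻ t in Ioi 0, ∫⁻ x, Φ (t, x) := by
        refine mul_le_mul_right (setLIntegral_mono' measurableSet_Ioi fun t ht => ?_) _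
        have ht' : 0 < t := ht
        refine (mul_le_mul_left (meas_lt_norm_fourier_le ht' hf hfm h1) _).trans (le_of_eq ?_)
        rw [mul_right_comm, ← ENNReal.ofReal_mul (by positivity),
          ← lintegral_const_mul' _ _ ENNReal.ofReal_ne_top]
        have e : 4 / t ^ 2 * t ^ (q - 1) = 4 * t ^ (q - 3) := by
          have : t ^ (q - 1) = t ^ 2 * t ^ (q - 3) := by
            rw [← Real.rpow_natCast, ← Real.rpow_add ht']
            congr 1
            push_cast
            ring
          rw [this]
          field_simp
        rw [e]
        refine lintegral_congr fun x => ?_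
        by_cases hx : t * ‖f x‖ ^ (p - 1) ≤ 2
        · rw [hΦ, indicator_of_mem (by exact hx), indicator_of_mem (by exact hx)]
        · rw [hΦ, indicator_of_notMem (by exact hx), indicator_of_notMem (by exact hx), mul_zero]
    _ = ENNReal.ofReal q * ∫⁻ x, ∫⁻ t in Ioi 0, Φ (t, x) := by
        rw [lintegral_lintegral_swap (f := fun t x => Φ (t, x)) hΦm.aemeasurable]
    _ ≤ ENNReal.ofReal q * ∫⁻ x, ENNReal.ofReal (4 * (2 ^ (q - 2) / (q - 2))) * ‖f x‖ₑ ^ p :=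
        mul_le_mul_right (lintegral_mono inner) _
    _ ≤ _ := by
        rw [lintegral_const_mul' _ _ ENNReal.ofReal_ne_top, ENNReal.ofReal_mul hq0.le]
        exact mul_le_mul_right (mul_le_of_le_one_right' h1) _

/-- The **Hausdorff–Young inequality**, with an unspecified constant. -/
theorem exists_eLpNorm_fourier_le (p q : ℝ≥0∞) [hpq : p.HolderConjugate q] (hp2 : p ≤ 2) :
    ∃ C : ℝ≥0∞, C < ∞ ∧ ∀ f : ℝ → ℂ, Integrable f →
      eLpNorm (𝓕 f) q volume ≤ C * eLpNorm f p volume := by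
  have hp1 : 1 ≤ p := ENNReal.HolderConjugate.one_le p q
  rcases hp1.eq_or_lt with rfl | hp1
  · have hq : q = ∞ := by
      have := ENNReal.HolderConjugate.inv_add_inv_eq_one 1 q
      simpa using this
    subst hq
    refine ⟨1, ENNReal.one_lt_top, fun f _ => ?_⟩
    rw [one_mul, eLpNorm_exponent_top, eLpNorm_one_eq_lintegral_enorm]
    exact eLpNormEssSup_le_of_ae_enorm_bound (Eventually.of_forall (enorm_fourier_le f))
  rcases hp2.eq_or_lt with rfl | hp2
  · have hq : q = 2 := by
      have := ENNReal.HolderConjugate.inv_add_inv_eq_one 2 q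
      have h2 : (2 : ℝ≥0∞)⁻¹ + q⁻¹ = 2⁻¹ + 2⁻¹ := by rw [this, ENNReal.inv_two_add_inv_two]
      exact inv_injective ((ENNReal.add_right_inj (by simp)).1 h2)
    subst hq
    exact ⟨1, ENNReal.one_lt_top, fun f hf => by rw [one_mul]; exact eLpNorm_fourier_two_le hf⟩
  have hpt : p ≠ ∞ := (hp2.trans (by norm_num)).ne
  have hp0 : p ≠ 0 := (zero_lt_one.trans hp1).ne'
  have hqt : q ≠ ∞ := ((ENNReal.HolderConjugate.lt_top_iff_one_lt q p).2 hp1).ne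
  have hq0 : q ≠ 0 := ENNReal.HolderConjugate.ne_zero q p
  have hP : p.toReal.HolderConjugate q.toReal := ENNReal.HolderConjugate.toReal_of_ne_top hpt hqt
  have hP2 : p.toReal < 2 := (ENNReal.toReal_lt_toReal hpt (by simp)).2 hp2
  set K := ENNReal.ofReal (q.toReal * (4 * (2 ^ (q.toReal - 2) / (q.toReal - 2))))
  have hbase : ∀ f : ℝ → ℂ, Integrable f → eLpNorm f p volume ≤ 1 →
      eLpNorm (𝓕 f) q volume ≤ K ^ (1 / q.toReal) := by
    intro f hf hf1
    -- The set used in the splitting needs a measurable function; the Fourier integral sees only the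
    -- almost everywhere class.
    set g := hf.1.mk f
    have hfg : f =ᵐ[volume] g := hf.1.ae_eq_mk
    have hFfg : 𝓕 f = 𝓕 g := funext fun w => Real.fourier_congr_ae hfg w
    rw [hFfg, eLpNorm_eq_lintegral_rpow_enorm_toReal hq0 hqt]
    refine ENNReal.rpow_le_rpow ?_ (by positivity)
    refine lintegral_enorm_fourier_rpow_le_of_le_one hP2 hP (hf.congr hfg)
      hf.1.stronglyMeasurable_mk.measurable ?_
    rw [eLpNorm_congr_ae hfg, eLpNorm_eq_lintegral_rpow_enorm_toReal hp0 hpt] at hf1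
    have := ENNReal.rpow_le_rpow hf1 hP.pos.le
    rwa [← ENNReal.rpow_mul, one_div_mul_cancel hP.pos.ne', ENNReal.rpow_one,
      ENNReal.one_rpow] at this
  -- The added `1` keeps the constant nonzero, so that its product with an infinite norm is
  -- infinite.
  refine ⟨K ^ (1 / q.toReal) + 1,
    ENNReal.add_lt_top.2 ⟨ENNReal.rpow_lt_top_of_nonneg (by positivity) ENNReal.ofReal_ne_top,
      ENNReal.one_lt_top⟩, fun f hf => ?_⟩
  by_cases h0 : eLpNorm f p volume = 0
  · rw [eLpNorm_eq_zero_iff hf.1 hp0] at h0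
    have : 𝓕 f = 0 := by
      funext w
      rw [Real.fourier_congr_ae h0 w]
      simp [Real.fourier_eq]
    simp [this]
  by_cases ht : eLpNorm f p volume = ∞
  · rw [ht, ENNReal.mul_top (by simp)]; exact le_top
  set N := (eLpNorm f p volume).toReal
  have hN : 0 < N := ENNReal.toReal_pos h0 ht
  have hNe : ‖((N⁻¹ : ℝ) : ℂ)‖ₑ = (eLpNorm f p volume)⁻¹ := by
    rw [← ofReal_norm, Complex.norm_real, Real.norm_of_nonneg (by positivity),
      ENNReal.ofReal_inv_of_pos hN, ENNReal.ofReal_toReal ht]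
  have h1 := hbase (((N⁻¹ : ℝ) : ℂ) • f) (hf.smul _) (by
    rw [eLpNorm_const_smul, hNe, ENNReal.inv_mul_cancel h0 ht])
  have hs : 𝓕 (((N⁻¹ : ℝ) : ℂ) • f) = ((N⁻¹ : ℝ) : ℂ) • 𝓕 f :=
    VectorFourier.fourierIntegral_const_smul _ _ _ _ _
  rw [hs, eLpNorm_const_smul, hNe, mul_comm, ← div_eq_mul_inv,
    ENNReal.div_le_iff h0 ht] at h1
  exact h1.trans (by gcongr; exact le_self_add)

end CesaroHardy

/-! ### The Laplace transform as a bounded map from `L_p` to `H_q`. -/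

namespace CesaroHardy

open scoped FourierTransform

lemma ae_halfLine {P : ℝ → Prop} (h : ∀ t, 0 < t → P t) : ∀ᵐ t ∂halfLine, P t :=
  (ae_restrict_iff' measurableSet_Ioi).2 (Eventually.of_forall fun t ht => h t ht)

lemma norm_exp_neg_mul (z : ℂ) (t : ℝ) :
    ‖Complex.exp (-(z * t))‖ = Real.exp (-(z.re * t)) := by
  rw [Complex.norm_exp]; simp

lemma memLp_exp {z : ℂ} (hz : z ∈ rightHalfPlane) (q : ℝ≥0∞) :
    MemLp (fun t : ℝ => Complex.exp (-(z * t))) q halfLine := by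
  have hz' : 0 < z.re := hz
  have hm : AEStronglyMeasurable (fun t : ℝ => Complex.exp (-(z * t))) halfLine :=
    (by fun_prop : Continuous fun t : ℝ => Complex.exp (-(z * t))).aestronglyMeasurable
  rcases eq_or_ne q 0 with rfl | hq0
  · exact memLp_zero_iff_aestronglyMeasurable.2 hm
  rcases eq_or_ne q ∞ with rfl | hqt
  · refine memLp_top_of_bound hm 1 (ae_halfLine fun t ht => ?_)
    rw [norm_exp_neg_mul, Real.exp_le_one_iff]
    nlinarith
  · rw [← integrable_norm_rpow_iff hm hq0 hqt]
    have h := exp_neg_integrableOn_Ioi 0 (mul_pos (ENNReal.toReal_pos hq0 hqt) hz')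
    refine h.congr (Eventually.of_forall fun t => ?_)
    change Real.exp _ = ‖Complex.exp (-(z * t))‖ ^ _
    rw [norm_exp_neg_mul, ← Real.exp_mul]
    congr 1
    ring

section

variable {p q : ℝ≥0∞}

lemma integrable_exp_mul [p.HolderConjugate q] {f : ℝ → ℂ} (hf : MemLp f p halfLine) {z : ℂ}
    (hz : z ∈ rightHalfPlane) : Integrable (fun t : ℝ => Complex.exp (-(z * t)) * f t) halfLine :=
  haveI : q.HolderConjugate p := ENNReal.HolderConjugate.symm
  (memLp_exp hz q).integrable_mul hf

lemma laplace_sub [p.HolderConjugate q] {f g : ℝ → ℂ} (hf : MemLp f p halfLine)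
    (hg : MemLp g p halfLine) {z : ℂ} (hz : z ∈ rightHalfPlane) :
    laplace (f - g) z = laplace f z - laplace g z := by
  unfold laplace
  rw [← integral_sub (integrable_exp_mul (q := q) hf hz) (integrable_exp_mul (q := q) hg hz)]
  simp [mul_sub]

lemma laplace_congr {f g : ℝ → ℂ} (h : f =ᵐ[halfLine] g) (z : ℂ) :
    laplace f z = laplace g z := by
  refine integral_congr_ae ?_
  filter_upwards [h] with t ht
  rw [ht]

lemma differentiableOn_laplace [p.HolderConjugate q] {f : ℝ → ℂ} (hf : MemLp f p halfLine) :
    DifferentiableOn ℂ (laplace f) rightHalfPlane := by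
  intro z hz
  have hz' : 0 < z.re := hz
  -- On the ball of radius `2c` one has `Re w ≥ 2c`. One factor `e^{-ct}` absorbs the `t` produced
  -- by differentiation, through `c t ≤ e^{ct}`; the other remains as the integrable majorant.
  set c : ℝ := z.re / 4 with hc
  have hc0 : 0 < c := by positivity
  have hcr : (c : ℂ) ∈ rightHalfPlane := by simpa [rightHalfPlane] using hc0
  have hfm := hf.aestronglyMeasurable
  have hexp : ∀ w : ℂ, AEStronglyMeasurable (fun t : ℝ => Complex.exp (-(w * t))) halfLine :=
    fun w => (by fun_prop : Continuous fun t : ℝ => Complex.exp (-(w * t))).aestronglyMeasurable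
  have hball : Metric.ball z (2 * c) ∈ 𝓝 z := Metric.ball_mem_nhds z (by positivity)
  refine (hasDerivAt_integral_of_dominated_loc_of_deriv_le (μ := halfLine)
    (F := fun (w : ℂ) (t : ℝ) => Complex.exp (-(w * t)) * f t)
    (F' := fun (w : ℂ) (t : ℝ) => Complex.exp (-(w * t)) * -t * f t)
    (bound := fun t => c⁻¹ * ‖Complex.exp (-(c * t)) * f t‖) hball
    (Eventually.of_forall fun w => (hexp w).mul hfm) (integrable_exp_mul (q := q) hf hz)
    (((hexp z).mul (by fun_prop : Continuous fun t : ℝ => -(t : ℂ)).aestronglyMeasurable).mul hfm)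
    (ae_halfLine fun t ht w hw => ?_)
    ((integrable_exp_mul (q := q) hf hcr).norm.const_mul _)
    (Eventually.of_forall fun t w _ => ?_)).2.differentiableAt.differentiableWithinAt
  · have hre : 2 * c ≤ w.re := by
      rw [Metric.mem_ball, Complex.dist_eq] at hw
      have h1 := (abs_le.1 (Complex.abs_re_le_norm (w - z))).1
      rw [Complex.sub_re] at h1
      linarith
    rw [norm_mul, norm_mul, norm_mul, norm_exp_neg_mul, norm_exp_neg_mul, norm_neg,
      Complex.norm_real, Real.norm_of_nonneg ht.le, ← mul_assoc, Complex.ofReal_re]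
    refine mul_le_mul_of_nonneg_right ?_ (norm_nonneg _)
    have h1 : c * t ≤ Real.exp (c * t) := by linarith [Real.add_one_le_exp (c * t)]
    have h2 : Real.exp (-(w.re * t)) ≤ Real.exp (-(c * t)) * Real.exp (-(c * t)) := by
      rw [← Real.exp_add, Real.exp_le_exp]
      nlinarith
    have h3 : Real.exp (-(c * t)) * Real.exp (c * t) = 1 := by
      rw [← Real.exp_add]; simp
    have h4 := Real.exp_pos (-(c * t))
    rw [inv_mul_eq_div, le_div_iff₀ hc0]
    calc Real.exp (-(w.re * t)) * t * c
        ≤ Real.exp (-(c * t)) * Real.exp (-(c * t)) * t * c := by gcongr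
      _ = Real.exp (-(c * t)) * (Real.exp (-(c * t)) * (c * t)) := by ring
      _ ≤ Real.exp (-(c * t)) * (Real.exp (-(c * t)) * Real.exp (c * t)) := by gcongr
      _ = Real.exp (-(c * t)) := by rw [h3, mul_one]
  · have h : HasDerivAt (fun w : ℂ => -(w * t)) (-(t : ℂ)) w := by
      convert! ((hasDerivAt_id w).mul_const (t : ℂ)).neg using 1
      simp
    exact h.cexp.mul_const _

/-- The Fourier integral has phase `e^{-2πi v y}`, hence the height `2πy` on the vertical line. -/
lemma laplace_eq_fourier (f : ℝ → ℂ) (x y : ℝ) :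
    laplace f (x + (2 * Real.pi * y : ℝ) * Complex.I) =
      𝓕 ((Ioi (0 : ℝ)).indicator fun t => Complex.exp (-(x * t)) * f t) y := by
  rw [Real.fourier_real_eq_integral_exp_smul]
  have e : (fun v : ℝ => Complex.exp (↑(-2 * Real.pi * v * y) * Complex.I) •
      (Ioi (0 : ℝ)).indicator (fun t : ℝ => Complex.exp (-(x * t)) * f t) v) =
      (Ioi (0 : ℝ)).indicator fun v : ℝ =>
        Complex.exp (-((x + (2 * Real.pi * y : ℝ) * Complex.I) * v)) * f v := by
    ext v
    by_cases hv : v ∈ Ioi (0 : ℝ)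
    · rw [indicator_of_mem hv, indicator_of_mem hv, smul_eq_mul, ← mul_assoc, ← Complex.exp_add]
      congr 2
      push_cast
      ring
    · simp [indicator_of_notMem hv]
  rw [e, integral_indicator measurableSet_Ioi]
  rfl

/-- The factor `1/2π` in the Hardy norm is exactly the Jacobian of the rescaling `y ↦ 2πy` between a
vertical slice and the Fourier integral. -/
lemma lineMeasure_eq_map : lineMeasure = Measure.map (2 * Real.pi * ·) volume := by
  have : (0 : ℝ) < 2 * Real.pi := by positivity
  rw [Real.map_volume_mul_left this.ne', lineMeasure, abs_of_pos (by positivity), one_div]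

lemma hardyNorm_congr {F G : ℂ → ℂ} (h : EqOn F G rightHalfPlane) (q : ℝ≥0∞) :
    hardyNorm q F = hardyNorm q G := by
  refine iSup_congr fun ⟨x, hx⟩ => ?_
  congr 1
  ext y
  refine h ?_
  simpa [rightHalfPlane] using hx

variable (p q) in
/-- The Laplace transform maps `L_p(ℝ⁺)` boundedly into `H_q(ℂ⁺)`. -/
lemma exists_hardyNorm_laplace_le [p.HolderConjugate q] (hp2 : p ≤ 2) :
    ∃ C : ℝ≥0∞, C < ∞ ∧ ∀ f : ℝ → ℂ, MemLp f p halfLine →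
      hardyNorm q (laplace f) ≤ C * eLpNorm f p halfLine := by
  obtain ⟨C, hC, h⟩ := exists_eLpNorm_fourier_le p q hp2
  refine ⟨C, hC, fun f hf => iSup_le fun ⟨x, hx⟩ => ?_⟩
  have hx' : 0 < x := hx
  have hxr : (x : ℂ) ∈ rightHalfPlane := by simpa [rightHalfPlane] using hx'
  have hint := integrable_exp_mul (q := q) hf hxr
  have hslice := continuous_slice (differentiableOn_laplace (q := q) hf) hx'
  have hcomp : (fun y : ℝ => laplace f ((x : ℝ) + y * Complex.I)) ∘ (2 * Real.pi * ·) =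
      𝓕 ((Ioi (0 : ℝ)).indicator fun t => Complex.exp (-(x * t)) * f t) :=
    funext fun y => laplace_eq_fourier f x y
  simp only
  rw [lineMeasure_eq_map, eLpNorm_map_measure hslice.aestronglyMeasurable (by fun_prop), hcomp]
  refine (h _ ((integrable_indicator_iff measurableSet_Ioi).2 hint)).trans ?_
  rw [eLpNorm_indicator_eq_eLpNorm_restrict measurableSet_Ioi]
  gcongr
  -- The damping factor `e^{-xt}` is at most `1`, which makes the bound uniform in `x > 0`.
  refine eLpNorm_mono_ae (ae_halfLine fun t ht => ?_)
  rw [norm_mul, norm_exp_neg_mul, Complex.ofReal_re]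
  refine mul_le_of_le_one_left (norm_nonneg _) ?_
  rw [Real.exp_le_one_iff]
  nlinarith

/-- The Laplace transform of `f ∈ L_p(ℝ⁺)` as an element of `H_q(ℂ⁺)`. -/
noncomputable def laplaceHardy [p.HolderConjugate q] [Fact (1 ≤ q)] (hp2 : p ≤ 2) {f : ℝ → ℂ}
    (hf : MemLp f p halfLine) : Hardy q :=
  ⟨rightHalfPlane.indicator (laplace f),
    (differentiableOn_laplace (q := q) hf).congr fun _ hz => indicator_of_mem hz _,
    fun _ hz => indicator_of_notMem hz _, by
      obtain ⟨C, hC, h⟩ := exists_hardyNorm_laplace_le p q hp2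
      rw [hardyNorm_congr (eqOn_indicator)]
      exact (h f hf).trans_lt (ENNReal.mul_lt_top hC hf.2)⟩

variable [p.HolderConjugate q] [Fact (1 ≤ q)]

lemma laplaceHardy_apply (hp2 : p ≤ 2) {f : ℝ → ℂ} (hf : MemLp f p halfLine) {z : ℂ}
    (hz : z ∈ rightHalfPlane) : (laplaceHardy hp2 hf : Hardy q) z = laplace f z :=
  indicator_of_mem hz _

lemma Hardy.ext_on {F G : Hardy q} (h : ∀ z ∈ rightHalfPlane, F z = G z) : F = G := by
  refine Hardy.ext (funext fun z => ?_)
  by_cases hz : z ∈ rightHalfPlane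
  · exact h z hz
  · rw [F.apply_eq_zero hz, G.apply_eq_zero hz]

lemma hasLaplaceTransform_laplaceHardy (hp2 : p ≤ 2) {f : ℝ → ℂ} (hf : MemLp f p halfLine) :
    HasLaplaceTransform f (laplaceHardy hp2 hf : Hardy q) := fun _ hz =>
  ⟨integrable_exp_mul (q := q) hf hz, (laplaceHardy_apply hp2 hf hz).symm⟩

-- Boundedness in Lipschitz form. It transfers continuity and uniform bounds of dilation orbits from
-- `L_p` to `H_q`.
variable (p q) in
lemma exists_norm_laplaceHardy_sub_le (hp2 : p ≤ 2) :
    ∃ C : ℝ, ∀ (f g : ℝ → ℂ) (hf : MemLp f p halfLine) (hg : MemLp g p halfLine),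
      ‖(laplaceHardy hp2 hf - laplaceHardy hp2 hg : Hardy q)‖ ≤
        C * (eLpNorm (f - g) p halfLine).toReal := by
  obtain ⟨C, hC, h⟩ := exists_hardyNorm_laplace_le p q hp2
  refine ⟨C.toReal, fun f g hf hg => ?_⟩
  rw [Hardy.norm_def, ← ENNReal.toReal_mul]
  refine ENNReal.toReal_mono (ENNReal.mul_lt_top hC (hf.sub hg).2).ne ?_
  refine (hardyNorm_congr (fun z hz => ?_) q).trans_le (h _ (hf.sub hg))
  rw [laplace_sub (q := q) hf hg hz, Hardy.coe_sub, Pi.sub_apply, laplaceHardy_apply hp2 hf hz,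
    laplaceHardy_apply hp2 hg hz]

end

/-! ### Dilation groups and their intertwining by the Laplace transform. -/

/-- The isometric dilation `D_t f(s) = e^{t/p} f(e^t s)` of `L_p(ℝ⁺)`. -/
noncomputable def realDilation (p : ℝ≥0∞) (t : ℝ) (f : ℝ → ℂ) (s : ℝ) : ℂ :=
  (Real.exp (t * (p⁻¹).toReal) : ℂ) * f (Real.exp t * s)

/-- The function `x ↦ e^{x/p} f(e^x)`, which represents `f ∈ L_p(ℝ⁺)` in `L_p(ℝ)`. -/
noncomputable def logModel (p : ℝ≥0∞) (f : ℝ → ℂ) (x : ℝ) : ℂ :=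
  (Real.exp (x * (p⁻¹).toReal) : ℂ) * f (Real.exp x)

section

variable {p : ℝ≥0∞}

/-- In the variable `x = log s` dilations become translations, so isometry and strong continuity
come from translation on `L_p(ℝ)`. -/
lemma logModel_realDilation (t : ℝ) (f : ℝ → ℂ) :
    logModel p (realDilation p t f) = logModel p f ∘ (t + ·) := by
  ext x
  simp only [logModel, realDilation, Function.comp, add_mul, Real.exp_add, Complex.ofReal_mul]
  ring

lemma logModel_sub (f g : ℝ → ℂ) : logModel p (f - g) = logModel p f - logModel p g := by
  ext x
  simp [logModel, mul_sub]

lemma measurable_logModel {f : ℝ → ℂ} (hf : Measurable f) : Measurable (logModel p f) := by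
  unfold logModel; fun_prop

lemma measurable_realDilation (t : ℝ) {f : ℝ → ℂ} (hf : Measurable f) :
    Measurable (realDilation p t f) := by
  unfold realDilation; fun_prop

lemma lintegral_halfLine_eq_comp_exp (g : ℝ → ℝ≥0∞) :
    ∫⁻ s, g s ∂halfLine = ∫⁻ x, ENNReal.ofReal (Real.exp x) * g (Real.exp x) := by
  have h := lintegral_image_eq_lintegral_abs_deriv_mul (f := Real.exp) (f' := Real.exp)
    MeasurableSet.univ (fun x _ => (Real.hasDerivAt_exp x).hasDerivWithinAt)
    Real.exp_injective.injOn g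
  rw [image_univ, Real.range_exp, Measure.restrict_univ] at h
  simpa [halfLine, abs_of_pos (Real.exp_pos _)] using h

/-- The weight `e^{x/p}` is the `p`-th root of the Jacobian of `s = e^x`. -/
lemma eLpNorm_logModel (hp0 : p ≠ 0) (hpt : p ≠ ∞) (f : ℝ → ℂ) :
    eLpNorm (logModel p f) p volume = eLpNorm f p halfLine := by
  rw [eLpNorm_eq_lintegral_rpow_enorm_toReal hp0 hpt,
    eLpNorm_eq_lintegral_rpow_enorm_toReal hp0 hpt, lintegral_halfLine_eq_comp_exp]
  congr 1
  refine lintegral_congr fun x => ?_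
  have hpos : 0 < p.toReal := ENNReal.toReal_pos hp0 hpt
  rw [logModel, enorm_mul, ENNReal.mul_rpow_of_nonneg _ _ hpos.le, ← ofReal_norm,
    Complex.norm_real, Real.norm_of_nonneg (Real.exp_pos _).le,
    ENNReal.ofReal_rpow_of_pos (Real.exp_pos _), ← Real.exp_mul, ENNReal.toReal_inv,
    mul_assoc, inv_mul_cancel₀ hpos.ne', mul_one]

lemma memLp_logModel (hp0 : p ≠ 0) (hpt : p ≠ ∞) {f : ℝ → ℂ} (hfm : Measurable f)
    (hf : MemLp f p halfLine) : MemLp (logModel p f) p volume :=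
  ⟨(measurable_logModel hfm).aestronglyMeasurable, by
    rw [eLpNorm_logModel hp0 hpt]; exact hf.2⟩

lemma eLpNorm_realDilation (hp0 : p ≠ 0) (hpt : p ≠ ∞) {f : ℝ → ℂ} (hfm : Measurable f) (t : ℝ) :
    eLpNorm (realDilation p t f) p halfLine = eLpNorm f p halfLine := by
  rw [← eLpNorm_logModel hp0 hpt, ← eLpNorm_logModel hp0 hpt, logModel_realDilation,
    eLpNorm_comp_measurePreserving (measurable_logModel hfm).aestronglyMeasurable
      (measurePreserving_add_left volume t)]

lemma memLp_realDilation (hp0 : p ≠ 0) (hpt : p ≠ ∞) {f : ℝ → ℂ} (hfm : Measurable f)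
    (hf : MemLp f p halfLine) (t : ℝ) : MemLp (realDilation p t f) p halfLine :=
  ⟨(measurable_realDilation t hfm).aestronglyMeasurable, by
    rw [eLpNorm_realDilation hp0 hpt hfm]; exact hf.2⟩

/-- Strong continuity of the dilation group on `L_p(ℝ⁺)`. -/
lemma tendsto_eLpNorm_realDilation_sub [Fact (1 ≤ p)] (hpt : p ≠ ∞) {f : ℝ → ℂ}
    (hfm : Measurable f) (hf : MemLp f p halfLine) (t₀ : ℝ) :
    Tendsto (fun t => (eLpNorm (realDilation p t f - realDilation p t₀ f) p halfLine).toReal)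
      (𝓝 t₀) (𝓝 0) := by
  have hp0 : p ≠ 0 := (zero_lt_one.trans_le (Fact.out : 1 ≤ p)).ne'
  have hg := memLp_logModel hp0 hpt hfm hf
  -- Translations as a continuous family of measure-preserving maps: composition with such a family
  -- is continuous in `L_p` for `p < ∞`.
  let τ : C(ℝ, C(ℝ, ℝ)) := ContinuousMap.curry ⟨fun x : ℝ × ℝ => x.1 + x.2, continuous_add⟩
  have hτ : ∀ t, MeasurePreserving (τ t) (volume : Measure ℝ) volume :=
    fun t => measurePreserving_add_left volume t
  have hc := (continuous_const (y := hg.toLp)).compMeasurePreservingLp τ.continuous hτ hpt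
  have hlim := tendsto_iff_norm_sub_tendsto_zero.1 (hc.tendsto t₀)
  refine hlim.congr fun t => ?_
  rw [Lp.toLp_compMeasurePreserving hg (hτ t), Lp.toLp_compMeasurePreserving hg (hτ t₀),
    ← MemLp.toLp_sub, Lp.norm_toLp, ← eLpNorm_logModel hp0 hpt, logModel_sub,
    logModel_realDilation, logModel_realDilation]
  rfl

variable {q : ℝ≥0∞} [p.HolderConjugate q] [Fact (1 ≤ q)]

lemma ne_top_of_le_two (hp2 : p ≤ 2) : p ≠ ∞ := (hp2.trans_lt (by norm_num)).ne

/-- `ℒ` intertwines the dilation groups of `L_p(ℝ⁺)` and `H_q(ℂ⁺)`. -/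
lemma dilation_laplaceHardy (hp2 : p ≤ 2) {f : ℝ → ℂ} (hf : MemLp f p halfLine) (t : ℝ)
    (hft : MemLp (realDilation p t f) p halfLine) :
    Hardy.dilation t (laplaceHardy hp2 hf : Hardy q) = laplaceHardy hp2 hft := by
  refine Hardy.ext_on fun z hz => ?_
  have hz' : 0 < z.re := hz
  have hmem : (Real.exp (-t) : ℂ) * z ∈ rightHalfPlane := by
    simp only [rightHalfPlane, mem_ofPred_eq, Complex.re_ofReal_mul]
    positivity
  change (Real.exp (-(t * (q⁻¹).toReal)) : ℂ) *
    (laplaceHardy hp2 hf : Hardy q) (Real.exp (-t) * z) = _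
  rw [laplaceHardy_apply hp2 hf hmem, laplaceHardy_apply hp2 hft hz]
  have hcv := integral_comp_mul_left_Ioi
    (fun u : ℝ => Complex.exp (-(Real.exp (-t) * z * u)) * f u) 0 (Real.exp_pos t)
  rw [mul_zero] at hcv
  have hsum : (p⁻¹).toReal + (q⁻¹).toReal = 1 := by
    have hp0 : p ≠ 0 := ENNReal.HolderConjugate.ne_zero p q
    have hq0 : q ≠ 0 := ENNReal.HolderConjugate.ne_zero q p
    rw [← ENNReal.toReal_add (ENNReal.inv_ne_top.2 hp0) (ENNReal.inv_ne_top.2 hq0),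
      ENNReal.HolderConjugate.inv_add_inv_eq_one, ENNReal.toReal_one]
  unfold laplace halfLine
  have e1 : ∫ u in Ioi (0 : ℝ), Complex.exp (-(Real.exp (-t) * z * u)) * f u =
      (Real.exp t : ℂ) * ∫ x in Ioi (0 : ℝ),
        Complex.exp (-(Real.exp (-t) * z * ↑(Real.exp t * x))) * f (Real.exp t * x) := by
    rw [hcv, Complex.real_smul, ← mul_assoc, ← Complex.ofReal_mul,
      mul_inv_cancel₀ (Real.exp_pos t).ne', Complex.ofReal_one, one_mul]
  rw [e1, ← mul_assoc, ← Complex.ofReal_mul, ← Real.exp_add, ← integral_const_mul]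
  refine integral_congr_ae (Eventually.of_forall fun x => ?_)
  -- The Jacobian `e^t` turns the weight `e^{-t/q}` of `T_q(t)` into the weight `e^{t/p}` of the
  -- real dilation, by conjugacy.
  have e2 : -(t * (q⁻¹).toReal) + t = t * (p⁻¹).toReal := by
    linear_combination t * (-hsum)
  have e3 : (Real.exp (-t) : ℂ) * Real.exp t = 1 := by
    rw [← Complex.ofReal_mul, ← Real.exp_add]; simp
  have e4 : -(Real.exp (-t) * z * ↑(Real.exp t * x)) = -(z * x) := by
    push_cast at e3 ⊢
    linear_combination (-(z * x)) * e3
  simp only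
  rw [e2, e4, realDilation]
  ring

/-- Continuity is pulled over from the orbit of `f` in `L_p`. This covers `q = ∞`, where `T_q` is
not strongly continuous on the whole Hardy space. -/
lemma continuous_dilation_laplaceHardy [Fact (1 ≤ p)] (hp2 : p ≤ 2) {f : ℝ → ℂ}
    (hfm : Measurable f) (hf : MemLp f p halfLine) :
    Continuous fun t => Hardy.dilation t (laplaceHardy hp2 hf : Hardy q) := by
  have hpt := ne_top_of_le_two hp2
  have hp0 : p ≠ 0 := (zero_lt_one.trans_le (Fact.out : 1 ≤ p)).ne'
  obtain ⟨C, hC⟩ := exists_norm_laplaceHardy_sub_le p q hp2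
  refine continuous_iff_continuousAt.2 fun t₀ => ?_
  have hd := memLp_realDilation hp0 hpt hfm hf
  refine tendsto_iff_norm_sub_tendsto_zero.2 ?_
  refine squeeze_zero (fun _ => norm_nonneg _) (fun t => ?_)
    (by simpa using (tendsto_eLpNorm_realDilation_sub hpt hfm hf t₀).const_mul C)
  beta_reduce
  rw [dilation_laplaceHardy hp2 hf t (hd t), dilation_laplaceHardy hp2 hf t₀ (hd t₀)]
  exact hC _ _ (hd t) (hd t₀)

lemma exists_norm_dilation_laplaceHardy_le [Fact (1 ≤ p)] (hp2 : p ≤ 2) {f : ℝ → ℂ}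
    (hfm : Measurable f) (hf : MemLp f p halfLine) :
    ∃ M : ℝ, ∀ t, ‖Hardy.dilation t (laplaceHardy hp2 hf : Hardy q)‖ ≤ M := by
  have hpt := ne_top_of_le_two hp2
  have hp0 : p ≠ 0 := (zero_lt_one.trans_le (Fact.out : 1 ≤ p)).ne'
  obtain ⟨C, hC⟩ := exists_norm_laplaceHardy_sub_le p q hp2
  have hd := memLp_realDilation hp0 hpt hfm hf
  refine ⟨C * (eLpNorm f p halfLine).toReal, fun t => ?_⟩
  -- The available estimate concerns differences, so the orbit is compared with the transform of
  -- zero.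
  have h0 : (laplaceHardy hp2 (MemLp.zero' (p := p) (μ := halfLine)) : Hardy q) = 0 := by
    refine Hardy.ext_on fun z hz => ?_
    rw [laplaceHardy_apply hp2 _ hz, Hardy.coe_zero]
    simp [laplace]
  have h := hC _ _ (hd t) MemLp.zero'
  rw [h0, sub_zero, ← dilation_laplaceHardy hp2 hf t (hd t)] at h
  refine h.trans_eq ?_
  rw [← eLpNorm_realDilation hp0 hpt hfm t]
  congr 3
  ext s
  simp

/-- Evaluation at a point of `ℂ⁺`, as a continuous linear functional on `H_q(ℂ⁺)`. -/
lemma Hardy.exists_evalCLM {z : ℂ} (hz : z ∈ rightHalfPlane) :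
    ∃ L : Hardy q →L[ℂ] ℂ, ∀ F, L F = F z := by
  have hz' : 0 < z.re := hz
  obtain ⟨C, hC, h⟩ := Hardy.exists_enorm_apply_le q (half_pos hz')
  let l : Hardy q →ₗ[ℂ] ℂ :=
    { toFun := fun F => F z
      map_add' := fun F G => rfl
      map_smul' := fun c F => rfl }
  refine ⟨l.mkContinuous C.toReal fun F => ?_, fun F => rfl⟩
  have h1 := h F z (half_lt_self hz')
  rw [Hardy.norm_def, ← ENNReal.toReal_mul, ← toReal_enorm]
  exact ENNReal.toReal_mono (ENNReal.mul_lt_top hC F.hardyNorm_lt_top).ne h1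

end

end CesaroHardy

/-! ### Operators subordinated to the dilation group. -/

namespace CesaroHardy

instance : SFinite halfLine := by unfold halfLine; infer_instance

/-- `s ↦ ∫₀^∞ k(t) D_{σ t} f(s) dt`, the operator on `L_p(ℝ⁺)` subordinated to the dilation
group by the kernel `k`. -/
noncomputable def subordinated (k : ℝ → ℝ) (p : ℝ≥0∞) (σ : ℝ) (f : ℝ → ℂ) (s : ℝ) : ℂ :=
  ∫ t, (k t : ℂ) * realDilation p (σ * t) f s ∂halfLine

lemma measurable_realDilation_uncurry (p : ℝ≥0∞) (σ : ℝ) {f : ℝ → ℂ} (hf : Measurable f) :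
    Measurable fun x : ℝ × ℝ => realDilation p (σ * x.2) f x.1 := by
  unfold realDilation
  fun_prop

lemma measurable_realDilation_time (p : ℝ≥0∞) (σ : ℝ) {f : ℝ → ℂ} (hf : Measurable f) (s : ℝ) :
    Measurable fun t : ℝ => realDilation p (σ * t) f s := by
  unfold realDilation
  fun_prop

lemma measurable_subordinated_integrand {k : ℝ → ℝ} (hk : Measurable k) (p : ℝ≥0∞) (σ : ℝ)
    {f : ℝ → ℂ} (hf : Measurable f) :
    Measurable fun x : ℝ × ℝ => (k x.2 : ℂ) * realDilation p (σ * x.2) f x.1 :=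
  (by fun_prop : Measurable fun x : ℝ × ℝ => (k x.2 : ℂ)).mul
    (measurable_realDilation_uncurry p σ hf)

/-- Hölder against the constant `1` on a space of mass `ν univ`. -/
lemma lintegral_rpow_le_of_one_le {ν : Measure ℝ} {P : ℝ} (hP : 1 ≤ P) {h : ℝ → ℝ≥0∞}
    (hh : AEMeasurable h ν) :
    (∫⁻ t, h t ∂ν) ^ P ≤ ν univ ^ (P - 1) * ∫⁻ t, h t ^ P ∂ν := by
  have hP0 : 0 < P := zero_lt_one.trans_le hP
  have h1 := eLpNorm_le_eLpNorm_mul_rpow_measure_univ (μ := ν) (f := h) (p := 1)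
    (q := ENNReal.ofReal P) (by simpa using hP) hh.aestronglyMeasurable
  rw [eLpNorm_one_eq_lintegral_enorm, eLpNorm_eq_lintegral_rpow_enorm_toReal (by simpa using hP0)
    ENNReal.ofReal_ne_top, ENNReal.toReal_ofReal hP0.le] at h1
  simp only [enorm_eq_self, ENNReal.toReal_one, div_one] at h1
  refine (ENNReal.rpow_le_rpow h1 hP0.le).trans (le_of_eq ?_)
  rw [ENNReal.mul_rpow_of_nonneg _ _ hP0.le, ← ENNReal.rpow_mul, ← ENNReal.rpow_mul,
    one_div_mul_cancel hP0.ne', ENNReal.rpow_one, mul_comm, sub_mul, one_mul,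
    one_div_mul_cancel hP0.ne']

variable {p : ℝ≥0∞} {k : ℝ → ℝ} {f : ℝ → ℂ}

lemma measurable_lintegral_subordinated (hk : Measurable k) (hfm : Measurable f) (σ : ℝ) :
    Measurable fun s => ∫⁻ t, ‖(k t : ℂ) * realDilation p (σ * t) f s‖ₑ ∂halfLine :=
  (measurable_subordinated_integrand hk p σ hfm).enorm.lintegral_prod_right'

variable [Fact (1 ≤ p)]

/-- Minkowski's integral inequality in weak form: apply Hölder for the finite measure `|k(t)| dt`,
exchange the integrals, and use that every dilation is an isometry. This one bound gives both almost
everywhere convergence and membership in `L_p`. -/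
lemma lintegral_subordinated_rpow_lt_top (hpt : p ≠ ∞) (hk : Measurable k)
    (hki : Integrable k halfLine) (hfm : Measurable f) (hf : MemLp f p halfLine) (σ : ℝ) :
    ∫⁻ s, (∫⁻ t, ‖(k t : ℂ) * realDilation p (σ * t) f s‖ₑ ∂halfLine) ^ p.toReal ∂halfLine
      < ∞ := by
  have hp1 : (1 : ℝ≥0∞) ≤ p := Fact.out
  have hp0 : p ≠ 0 := (zero_lt_one.trans_le hp1).ne'
  have hP : 1 ≤ p.toReal := by
    simpa using (ENNReal.toReal_le_toReal ENNReal.one_ne_top hpt).2 hp1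
  obtain ⟨ν, hν⟩ : ∃ ν : Measure ℝ, ν = halfLine.withDensity fun t => ‖k t‖ₑ := ⟨_, rfl⟩
  have hkm : Measurable fun t => ‖k t‖ₑ := hk.enorm
  have hνu : ν univ < ∞ := by
    rw [hν, withDensity_apply _ MeasurableSet.univ, Measure.restrict_univ]
    exact hki.2
  have : IsFiniteMeasure ν := ⟨hνu⟩
  have hDm : Measurable fun x : ℝ × ℝ => ‖realDilation p (σ * x.2) f x.1‖ₑ := by
    exact (measurable_realDilation_uncurry p σ hfm).enorm
  have hDt : ∀ s, Measurable fun t => ‖realDilation p (σ * t) f s‖ₑ := fun s =>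
    (measurable_realDilation_time p σ hfm s).enorm
  calc ∫⁻ s, (∫⁻ t, ‖(k t : ℂ) * realDilation p (σ * t) f s‖ₑ ∂halfLine) ^ p.toReal ∂halfLine
      = ∫⁻ s, (∫⁻ t, ‖realDilation p (σ * t) f s‖ₑ ∂ν) ^ p.toReal ∂halfLine := by
        refine lintegral_congr fun s => ?_
        rw [hν, lintegral_withDensity_eq_lintegral_mul _ hkm (hDt s)]
        congr 1
        refine lintegral_congr fun t => ?_
        rw [enorm_mul, Pi.mul_apply, ← ofReal_norm (k t : ℂ), Complex.norm_real, ofReal_norm]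
    _ ≤ ∫⁻ s, ν univ ^ (p.toReal - 1) *
          ∫⁻ t, ‖realDilation p (σ * t) f s‖ₑ ^ p.toReal ∂ν ∂halfLine :=
        lintegral_mono fun s => lintegral_rpow_le_of_one_le hP (hDt s).aemeasurable
    _ = ν univ ^ (p.toReal - 1) *
          ∫⁻ t, ∫⁻ s, ‖realDilation p (σ * t) f s‖ₑ ^ p.toReal ∂halfLine ∂ν := by
        rw [lintegral_const_mul' _ _
          (ENNReal.rpow_ne_top_of_nonneg (by linarith) hνu.ne), lintegral_lintegral_swap]
        exact (hDm.pow_const _).aemeasurable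
    _ = ν univ ^ (p.toReal - 1) * (eLpNorm f p halfLine ^ p.toReal * ν univ) := by
        congr 1
        rw [← lintegral_const]
        refine lintegral_congr fun t => ?_
        rw [← eLpNorm_realDilation hp0 hpt hfm (σ * t),
          eLpNorm_eq_lintegral_rpow_enorm_toReal hp0 hpt, ← ENNReal.rpow_mul,
          one_div_mul_cancel (by positivity), ENNReal.rpow_one]
    _ < ∞ := ENNReal.mul_lt_top (ENNReal.rpow_lt_top_of_nonneg (by linarith) hνu.ne)
        (ENNReal.mul_lt_top (ENNReal.rpow_lt_top_of_nonneg (by linarith) hf.2.ne) hνu)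

lemma ae_integrable_subordinated (hpt : p ≠ ∞) (hk : Measurable k)
    (hki : Integrable k halfLine) (hfm : Measurable f) (hf : MemLp f p halfLine) (σ : ℝ) :
    ∀ᵐ s ∂halfLine, Integrable (fun t => (k t : ℂ) * realDilation p (σ * t) f s) halfLine := by
  have hp0 : p ≠ 0 := (zero_lt_one.trans_le (Fact.out : (1 : ℝ≥0∞) ≤ p)).ne'
  have h := ae_lt_top ((measurable_lintegral_subordinated (p := p) hk hfm σ).pow_const _)
    (lintegral_subordinated_rpow_lt_top hpt hk hki hfm hf σ).ne
  filter_upwards [h] with s hs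
  refine ⟨((measurable_subordinated_integrand hk p σ hfm).comp
    measurable_prodMk_left).aestronglyMeasurable, ?_⟩
  exact (ENNReal.rpow_lt_top_iff_of_pos (ENNReal.toReal_pos hp0 hpt)).1 hs

/-- Stated for any dominated `g` so that it serves both the subordinated function and the integral
of absolute values needed for Fubini. -/
lemma memLp_of_enorm_le_lintegral_subordinated (hpt : p ≠ ∞) (hk : Measurable k)
    (hki : Integrable k halfLine) (hfm : Measurable f) (hf : MemLp f p halfLine) (σ : ℝ)
    {g : ℝ → ℂ} (hg : AEStronglyMeasurable g halfLine)
    (hle : ∀ s, ‖g s‖ₑ ≤ ∫⁻ t, ‖(k t : ℂ) * realDilation p (σ * t) f s‖ₑ ∂halfLine) :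
    MemLp g p halfLine := by
  have hp0 : p ≠ 0 := (zero_lt_one.trans_le (Fact.out : (1 : ℝ≥0∞) ≤ p)).ne'
  refine ⟨hg, ?_⟩
  rw [eLpNorm_lt_top_iff_lintegral_rpow_enorm_lt_top hp0 hpt]
  refine (lintegral_mono fun s => ?_).trans_lt
    (lintegral_subordinated_rpow_lt_top hpt hk hki hfm hf σ)
  exact ENNReal.rpow_le_rpow (hle s) ENNReal.toReal_nonneg

lemma memLp_subordinated (hpt : p ≠ ∞) (hk : Measurable k)
    (hki : Integrable k halfLine) (hfm : Measurable f) (hf : MemLp f p halfLine) (σ : ℝ) :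
    MemLp (subordinated k p σ f) p halfLine :=
  memLp_of_enorm_le_lintegral_subordinated hpt hk hki hfm hf σ
    ((measurable_subordinated_integrand hk p σ hfm).stronglyMeasurable.integral_prod_right'
      ).aestronglyMeasurable
    fun _ => enorm_integral_le_lintegral_enorm _

variable {q : ℝ≥0∞} [p.HolderConjugate q] [Fact (1 ≤ q)]

lemma integrable_dilation_laplaceHardy (hp2 : p ≤ 2) (hki : Integrable k halfLine)
    (hfm : Measurable f) (hf : MemLp f p halfLine) (σ : ℝ) :
    Integrable (fun t => k t • Hardy.dilation (σ * t) (laplaceHardy hp2 hf : Hardy q))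
      halfLine := by
  obtain ⟨M, hM⟩ := exists_norm_dilation_laplaceHardy_le (q := q) hp2 hfm hf
  have hc : Continuous fun t => Hardy.dilation (σ * t) (laplaceHardy hp2 hf : Hardy q) :=
    (continuous_dilation_laplaceHardy hp2 hfm hf).comp (continuous_const.mul continuous_id)
  exact hki.smul_bdd M hc.aestronglyMeasurable (Eventually.of_forall fun t => hM _)

/-- Evaluation at `z` is a continuous functional and passes inside the Bochner integral. What
remains is a scalar double integral, exchanged by Fubini, whose inner integral is the Laplace
transform of a dilate. -/
lemma laplace_subordinated (hp2 : p ≤ 2) (hk : Measurable k) (hki : Integrable k halfLine)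
    (hfm : Measurable f) (hf : MemLp f p halfLine) (σ : ℝ) {z : ℂ} (hz : z ∈ rightHalfPlane) :
    laplace (subordinated k p σ f) z =
      (∫ t, k t • Hardy.dilation (σ * t) (laplaceHardy hp2 hf : Hardy q) ∂halfLine : Hardy q)
        z := by
  have hpt := ne_top_of_le_two hp2
  have hp0 : p ≠ 0 := (zero_lt_one.trans_le (Fact.out : (1 : ℝ≥0∞) ≤ p)).ne'
  have hmeas := measurable_subordinated_integrand hk p σ hfm
  have hprod : Integrable (Function.uncurry fun s t : ℝ =>
      Complex.exp (-(z * s)) * ((k t : ℂ) * realDilation p (σ * t) f s))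
      (halfLine.prod halfLine) := by
    have hm : Measurable (Function.uncurry fun s t : ℝ =>
        Complex.exp (-(z * s)) * ((k t : ℂ) * realDilation p (σ * t) f s)) :=
      (by fun_prop : Measurable fun x : ℝ × ℝ => Complex.exp (-(z * x.1))).mul hmeas
    refine (integrable_prod_iff hm.aestronglyMeasurable).2 ⟨?_, ?_⟩
    · filter_upwards [ae_integrable_subordinated hpt hk hki hfm hf σ] with s hs
      exact hs.const_mul (Complex.exp (-(z * s)))
    -- The inner integral of absolute values lies in `L_p`, so its product with the exponential is
    -- integrable by Hölder; the cast to `ℂ` allows `integrable_exp_mul` to be reused.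
    · have hB : MemLp (fun s => ((∫ t, ‖(k t : ℂ) * realDilation p (σ * t) f s‖ ∂halfLine : ℝ) : ℂ))
          p halfLine := by
        refine memLp_of_enorm_le_lintegral_subordinated hpt hk hki hfm hf σ ?_ fun s => ?_
        · exact (Complex.measurable_ofReal.comp
            (hmeas.norm.stronglyMeasurable.integral_prod_right').measurable).aestronglyMeasurable
        · rw [← ofReal_norm, Complex.norm_real, ofReal_norm]
          refine (enorm_integral_le_lintegral_enorm _).trans (le_of_eq ?_)
          exact lintegral_congr fun t => enorm_norm _
      refine (integrable_exp_mul (q := q) hB hz).norm.congr (Eventually.of_forall fun s => ?_)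
      simp only [Function.uncurry, norm_mul (Complex.exp _)]
      rw [integral_const_mul, Complex.norm_real,
        Real.norm_of_nonneg (integral_nonneg fun _ => norm_nonneg _)]
  obtain ⟨L, hL⟩ := Hardy.exists_evalCLM (q := q) hz
  rw [← hL, ← L.integral_comp_comm (integrable_dilation_laplaceHardy hp2 hki hfm hf σ)]
  unfold laplace subordinated
  simp only [← integral_const_mul]
  rw [integral_integral_swap hprod]
  refine integral_congr_ae (Eventually.of_forall fun t => ?_)
  have hd := memLp_realDilation hp0 hpt hfm hf (σ * t)
  have hsm : k t • Hardy.dilation (σ * t) (laplaceHardy hp2 hf : Hardy q) =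
      (k t : ℂ) • Hardy.dilation (σ * t) (laplaceHardy hp2 hf : Hardy q) :=
    (Complex.coe_smul _ _).symm
  simp only
  rw [hsm, map_smul, hL, dilation_laplaceHardy hp2 hf _ hd, laplaceHardy_apply hp2 hd hz,
    laplace, smul_eq_mul, ← integral_const_mul]
  refine integral_congr_ae (Eventually.of_forall fun s => ?_)
  simp only
  ring

end CesaroHardy

/-! ### Integrability of the kernel. -/

namespace CesaroHardy

section kernel

variable {α : ℝ} {p : ℝ≥0∞}

lemma measurable_kernel : Measurable (kernel α p) := by
  unfold kernel
  fun_prop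

lemma image_exp_mul_Ioi {s : ℝ} (hs : 0 < s) : (fun t => Real.exp t * s) '' Ioi 0 = Ioi s := by
  ext u
  constructor
  · rintro ⟨t, ht, rfl⟩
    exact (lt_mul_iff_one_lt_left hs).2 (Real.one_lt_exp_iff.2 ht)
  · intro hu
    have hu' : s < u := hu
    refine ⟨Real.log (u / s), Real.log_pos ((one_lt_div hs).2 hu'), ?_⟩
    simp only
    rw [Real.exp_log (div_pos (hs.trans hu') hs), div_mul_cancel₀ _ hs.ne']

lemma image_exp_neg_mul_Ioi {s : ℝ} (hs : 0 < s) :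
    (fun t => Real.exp (-t) * s) '' Ioi 0 = Ioo 0 s := by
  ext u
  constructor
  · rintro ⟨t, ht, rfl⟩
    have ht' : 0 < t := ht
    exact ⟨by positivity,
      (mul_lt_iff_lt_one_left hs).2 (Real.exp_lt_one_iff.2 (by linarith))⟩
  · rintro ⟨h0, hu⟩
    refine ⟨-Real.log (u / s), neg_pos.2 (Real.log_neg (by positivity) ((div_lt_one hs).2 hu)), ?_⟩
    simp only
    rw [neg_neg, Real.exp_log (by positivity), div_mul_cancel₀ _ hs.ne']

lemma hasDerivAt_exp_mul (s t : ℝ) : HasDerivAt (fun t => Real.exp t * s) (Real.exp t * s) t :=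
  (Real.hasDerivAt_exp t).mul_const s

lemma hasDerivAt_exp_neg_mul (s t : ℝ) :
    HasDerivAt (fun t => Real.exp (-t) * s) (-(Real.exp (-t) * s)) t := by
  simpa using ((hasDerivAt_neg t).exp.mul_const s)

lemma injective_exp_mul {s : ℝ} (hs : 0 < s) : Function.Injective fun t => Real.exp t * s :=
  fun _ _ h => Real.exp_injective (mul_right_cancel₀ hs.ne' h)

lemma injective_exp_neg_mul {s : ℝ} (hs : 0 < s) :
    Function.Injective fun t => Real.exp (-t) * s :=
  fun _ _ h => neg_injective (Real.exp_injective (mul_right_cancel₀ hs.ne' h))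

lemma one_sub_exp_neg_pos {t : ℝ} (ht : 0 < t) : 0 < 1 - Real.exp (-t) :=
  sub_pos.2 (Real.exp_lt_one_iff.2 (by linarith))

lemma integrableOn_rpow_mul_one_sub_rpow {a b : ℝ} (ha : 0 < a) (hb : 0 < b) :
    IntegrableOn (fun u : ℝ => u ^ (a - 1) * (1 - u) ^ (b - 1)) (Ioo 0 1) := by
  have h := Complex.betaIntegral_convergent (u := a) (v := b) (by simpa) (by simpa)
  rw [intervalIntegrable_iff_integrableOn_Ioo_of_le zero_le_one] at h
  refine h.norm.congr ((ae_restrict_iff' measurableSet_Ioo).2 (Eventually.of_forall fun u hu => ?_))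
  have h1 : (1 - u : ℂ) = ((1 - u : ℝ) : ℂ) := by push_cast; rfl
  beta_reduce
  rw [norm_mul, h1, Complex.norm_cpow_eq_rpow_re_of_pos hu.1,
    Complex.norm_cpow_eq_rpow_re_of_pos (sub_pos.2 hu.2)]
  simp

/-- With `u = e^{-t}` the integral becomes `α ∫₀¹ u^{1/p-1} (1-u)^{α-1} du`: `p < ∞` gives
convergence at `u = 0`, and `α > 0` gives it at `u = 1`. -/
lemma integrable_kernel (hα : 0 < α) (hp0 : p ≠ 0) (hpt : p ≠ ∞) :
    Integrable (kernel α p) halfLine := by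
  have hb : 0 < (p⁻¹).toReal :=
    ENNReal.toReal_pos (ENNReal.inv_ne_zero.2 hpt) (ENNReal.inv_ne_top.2 hp0)
  have h := (integrableOn_rpow_mul_one_sub_rpow hb hα).const_mul α
  change IntegrableOn _ (Ioo (0 : ℝ) 1) volume at h
  rw [← image_exp_neg_mul_Ioi one_pos, integrableOn_image_iff_integrableOn_abs_deriv_smul
    measurableSet_Ioi (fun t _ => (hasDerivAt_exp_neg_mul 1 t).hasDerivWithinAt)
    (injective_exp_neg_mul one_pos).injOn] at h
  refine h.congr (Eventually.of_forall fun t => ?_)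
  have hpos := Real.exp_pos (-t)
  simp only [mul_one, abs_neg, abs_of_pos hpos, smul_eq_mul, kernel]
  rw [← Real.exp_mul, mul_sub, mul_one, sub_eq_add_neg, neg_neg, Real.exp_add, Real.exp_neg t,
    neg_mul]
  field_simp

end kernel

/-! ### The real operators as averages of dilations. -/

section realOperators

variable {α : ℝ} {f g : ℝ → ℂ}

lemma ae_eq_restrict_of_subset {S : Set ℝ} (h : f =ᵐ[halfLine] g) (hS : S ⊆ Ioi 0) :
    f =ᵐ[volume.restrict S] g :=
  ae_restrict_of_ae_restrict_of_subset hS h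

lemma cesaroStarIntegrand_congr (h : f =ᵐ[halfLine] g) {s : ℝ} (hs : 0 < s) :
    cesaroStarIntegrand α f s =ᵐ[volume.restrict (Ioi s)] cesaroStarIntegrand α g s := by
  filter_upwards [ae_eq_restrict_of_subset h (Ioi_subset_Ioi hs.le)] with u hu
  rw [cesaroStarIntegrand, cesaroStarIntegrand, hu]

lemma cesaroIntegrand_congr (h : f =ᵐ[halfLine] g) {s : ℝ} :
    cesaroIntegrand α f s =ᵐ[volume.restrict (Ioo 0 s)] cesaroIntegrand α g s := by
  filter_upwards [ae_eq_restrict_of_subset h Ioo_subset_Ioi_self] with u hu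
  rw [cesaroIntegrand, cesaroIntegrand, hu]

/-- The pointwise form of `u = e^t s`. Since `u - s = u (1 - e^{-t})`, all powers of `u`, Jacobian
included, cancel. Any `p` is allowed: the weight `e^{t/p}` of the dilation cancels `e^{-t/p}` in the
kernel. -/
lemma mul_abs_smul_cesaroStarIntegrand (p : ℝ≥0∞) {s t : ℝ} (hs : 0 < s) (ht : 0 < t) :
    (α : ℂ) * (|Real.exp t * s| • cesaroStarIntegrand α f s (Real.exp t * s)) =
      (kernel α p t : ℂ) * realDilation p (1 * t) f s := by
  have hX : 0 < Real.exp t * s := by positivity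
  have h1 : Real.exp t * s - s = Real.exp t * s * (1 - Real.exp (-t)) := by
    have : Real.exp t * Real.exp (-t) = 1 := by rw [← Real.exp_add]; simp
    linear_combination s * this
  have key : α * (Real.exp t * s * ((Real.exp t * s - s) ^ (α - 1) / (Real.exp t * s) ^ α)) =
      kernel α p t * Real.exp (1 * t * (p⁻¹).toReal) := by
    rw [kernel, mul_assoc _ (Real.exp _), ← Real.exp_add, one_mul, neg_add_cancel, Real.exp_zero,
      mul_one, h1, Real.mul_rpow hX.le (one_sub_exp_neg_pos ht).le, Real.rpow_sub_one hX.ne']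
    have := (Real.rpow_pos_of_pos hX α).ne'
    field_simp
  rw [abs_of_pos hX, cesaroStarIntegrand, realDilation, Complex.real_smul, ← mul_assoc,
    ← mul_assoc, ← Complex.ofReal_mul, ← Complex.ofReal_mul, mul_assoc α, key, ← mul_assoc,
    ← Complex.ofReal_mul, one_mul]

/-- The pointwise form of `u = e^{-t} s`. Conjugacy is essential here: the kernel weight `e^{-t/p}`
and the dilation weight `e^{-t/q}` must multiply to the factor `e^{-t}` of the Jacobian. -/
lemma mul_abs_smul_cesaroIntegrand {p q : ℝ≥0∞} (hpq : (p⁻¹).toReal + (q⁻¹).toReal = 1) {s t : ℝ}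
    (hs : 0 < s) (ht : 0 < t) :
    ((α / s ^ α : ℝ) : ℂ) * (|-(Real.exp (-t) * s)| • cesaroIntegrand α f s (Real.exp (-t) * s)) =
      (kernel α p t : ℂ) * realDilation q (-1 * t) f s := by
  have hX : 0 < Real.exp (-t) * s := by positivity
  have h1 : s - Real.exp (-t) * s = s * (1 - Real.exp (-t)) := by ring
  have key : α / s ^ α * (Real.exp (-t) * s * (s - Real.exp (-t) * s) ^ (α - 1)) =
      kernel α p t * Real.exp (-1 * t * (q⁻¹).toReal) := by
    have e : -(t * (p⁻¹).toReal) + -1 * t * (q⁻¹).toReal = -t := by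
      linear_combination (-t) * hpq
    rw [kernel, mul_assoc _ (Real.exp _), ← Real.exp_add, e, h1,
      Real.mul_rpow hs.le (one_sub_exp_neg_pos ht).le, Real.rpow_sub_one hs.ne']
    have := (Real.rpow_pos_of_pos hs α).ne'
    field_simp
  rw [abs_neg, abs_of_pos hX, cesaroIntegrand, realDilation, Complex.real_smul, ← mul_assoc,
    ← mul_assoc, ← Complex.ofReal_mul, ← Complex.ofReal_mul, mul_assoc (α / s ^ α), key,
    ← mul_assoc, ← Complex.ofReal_mul, neg_one_mul t]

lemma integrableOn_cesaroStarIntegrand (hα : 0 < α) (p : ℝ≥0∞) {s : ℝ} (hs : 0 < s)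
    (h : Integrable (fun t => (kernel α p t : ℂ) * realDilation p (1 * t) f s) halfLine) :
    IntegrableOn (cesaroStarIntegrand α f s) (Ioi s) := by
  rw [← image_exp_mul_Ioi hs, integrableOn_image_iff_integrableOn_abs_deriv_smul
    measurableSet_Ioi (fun t _ => (hasDerivAt_exp_mul s t).hasDerivWithinAt)
    (injective_exp_mul hs).injOn]
  refine (h.const_mul (α : ℂ)⁻¹).congr (ae_halfLine fun t ht => ?_)
  beta_reduce
  rw [← mul_abs_smul_cesaroStarIntegrand p hs ht, inv_mul_cancel_left₀]
  exact_mod_cast hα.ne'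

lemma cesaroStar_eq_subordinated (p : ℝ≥0∞) {s : ℝ} (hs : 0 < s) :
    cesaroStar α f s = subordinated (kernel α p) p 1 f s := by
  rw [cesaroStar, ← image_exp_mul_Ioi hs, integral_image_eq_integral_abs_deriv_smul
    measurableSet_Ioi (fun t _ => (hasDerivAt_exp_mul s t).hasDerivWithinAt)
    (injective_exp_mul hs).injOn, ← integral_const_mul]
  exact integral_congr_ae (ae_halfLine fun t ht => mul_abs_smul_cesaroStarIntegrand p hs ht)

lemma integrableOn_cesaroIntegrand (hα : 0 < α) {p q : ℝ≥0∞}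
    (hpq : (p⁻¹).toReal + (q⁻¹).toReal = 1) {s : ℝ} (hs : 0 < s)
    (h : Integrable (fun t => (kernel α p t : ℂ) * realDilation q (-1 * t) f s) halfLine) :
    IntegrableOn (cesaroIntegrand α f s) (Ioo 0 s) := by
  rw [← image_exp_neg_mul_Ioi hs, integrableOn_image_iff_integrableOn_abs_deriv_smul
    measurableSet_Ioi (fun t _ => (hasDerivAt_exp_neg_mul s t).hasDerivWithinAt)
    (injective_exp_neg_mul hs).injOn]
  refine (h.const_mul ((α / s ^ α : ℝ) : ℂ)⁻¹).congr (ae_halfLine fun t ht => ?_)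
  beta_reduce
  rw [← mul_abs_smul_cesaroIntegrand hpq hs ht, inv_mul_cancel_left₀]
  exact_mod_cast (div_pos hα (Real.rpow_pos_of_pos hs α)).ne'

lemma cesaro_eq_subordinated {p q : ℝ≥0∞} (hpq : (p⁻¹).toReal + (q⁻¹).toReal = 1) {s : ℝ}
    (hs : 0 < s) : cesaro α f s = subordinated (kernel α p) q (-1) f s := by
  rw [cesaro, ← image_exp_neg_mul_Ioi hs, integral_image_eq_integral_abs_deriv_smul
    measurableSet_Ioi (fun t _ => (hasDerivAt_exp_neg_mul s t).hasDerivWithinAt)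
    (injective_exp_neg_mul hs).injOn, ← integral_const_mul]
  exact integral_congr_ae (ae_halfLine fun t ht => mul_abs_smul_cesaroIntegrand hpq hs ht)

end realOperators

/-! ### The Riemann–Lebesgue lemma on the closed half-plane. -/

section A0

variable {f : ℝ → ℂ}

lemma norm_exp_mul_le {z : ℂ} (hz : 0 ≤ z.re) {t : ℝ} (ht : 0 < t) (w : ℂ) :
    ‖Complex.exp (-(z * t)) * w‖ ≤ ‖w‖ := by
  rw [norm_mul, norm_exp_neg_mul]
  refine mul_le_of_le_one_left (norm_nonneg _) (Real.exp_le_one_iff.2 ?_)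
  have := mul_nonneg hz ht.le
  linarith

lemma integrable_exp_mul_of_re_nonneg (hf : Integrable f halfLine) {z : ℂ} (hz : 0 ≤ z.re) :
    Integrable (fun t : ℝ => Complex.exp (-(z * t)) * f t) halfLine :=
  hf.mono ((by fun_prop : Continuous fun t : ℝ => Complex.exp (-(z * t))).aestronglyMeasurable.mul
    hf.1) (ae_halfLine fun _ ht => norm_exp_mul_le hz ht _)

lemma norm_laplace_le (hf : Integrable f halfLine) {z : ℂ} (hz : 0 ≤ z.re) :
    ‖laplace f z‖ ≤ ∫ t, ‖f t‖ ∂halfLine :=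
  norm_integral_le_of_norm_le hf.norm (ae_halfLine fun _ ht => norm_exp_mul_le hz ht _)

lemma continuousOn_laplace (hf : Integrable f halfLine) :
    ContinuousOn (laplace f) {z | 0 ≤ z.re} := by
  refine continuousOn_of_dominated (bound := fun t => ‖f t‖) (fun z hz =>
    (integrable_exp_mul_of_re_nonneg hf hz).1) (fun z hz => ae_halfLine fun t ht =>
    norm_exp_mul_le hz ht _) hf.norm (Eventually.of_forall fun t => ?_)
  fun_prop

/-- Integration by parts gives `z ℒφ(z) = φ(0) + ℒφ'(z)`. The boundary term stays because the
support of `φ` is compact in `ℝ`, not in `(0, ∞)`. -/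
lemma norm_mul_norm_laplace_le {φ : ℝ → ℂ} (hφ : ContDiff ℝ 1 φ) (hc : HasCompactSupport φ)
    {z : ℂ} (hz : 0 ≤ z.re) :
    ‖z‖ * ‖laplace φ z‖ ≤ ‖φ 0‖ + ∫ t, ‖deriv φ t‖ ∂halfLine := by
  have hφi : Integrable φ halfLine := (hφ.continuous.integrable_of_hasCompactSupport hc).restrict
  have hφ'i : Integrable (deriv φ) halfLine :=
    ((hφ.continuous_deriv le_rfl).integrable_of_hasCompactSupport hc.deriv).restrict
  have hi1 := integrable_exp_mul_of_re_nonneg hφi hz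
  have hi2 := integrable_exp_mul_of_re_nonneg hφ'i hz
  have hder : ∀ t : ℝ, HasDerivAt (fun t : ℝ => Complex.exp (-(z * t)) * φ t)
      (-z * (Complex.exp (-(z * t)) * φ t) + Complex.exp (-(z * t)) * deriv φ t) t := by
    intro t
    have h1 : HasDerivAt (fun t : ℝ => -(z * t)) (-z) t := by
      convert! ((Complex.ofRealCLM.hasDerivAt (x := t)).const_mul z).neg using 1
      simp
    convert! h1.cexp.mul ((hφ.differentiable one_ne_zero t).hasDerivAt) using 1
    ring
  have hlim : Tendsto (fun t : ℝ => Complex.exp (-(z * t)) * φ t) atTop (𝓝 0) := by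
    refine tendsto_const_nhds.congr' ?_
    obtain ⟨R, hR⟩ := hc.isCompact.bddAbove
    filter_upwards [eventually_gt_atTop R] with t ht
    rw [image_eq_zero_of_notMem_tsupport fun h => (hR h).not_gt ht, mul_zero]
  have hFTC := integral_Ioi_of_hasDerivAt_of_tendsto (a := 0)
    (hder 0).continuousAt.continuousWithinAt (fun t _ => hder t)
    ((hi1.const_mul (-z)).add hi2) hlim
  change ∫ t, _ ∂halfLine = _ at hFTC
  rw [integral_add (hi1.const_mul (-z)) hi2, integral_const_mul] at hFTC
  have h3 : z * laplace φ z = φ 0 + laplace (deriv φ) z := by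
    have : -z * laplace φ z + laplace (deriv φ) z = 0 - φ 0 := by
      simpa [laplace] using hFTC
    linear_combination -this
  rw [← norm_mul, h3]
  exact (norm_add_le _ _).trans (add_le_add_right (norm_laplace_le hφ'i hz) _)

/-- The Riemann–Lebesgue lemma for the Laplace transform on the closed right half-plane. -/
lemma tendsto_laplace_cocompact (hf : Integrable f halfLine) :
    Tendsto (laplace f) (cocompact ℂ ⊓ 𝓟 {z | 0 ≤ z.re}) (𝓝 0) := by
  rw [Metric.tendsto_nhds]
  intro ε hε
  have hfI : MemLp ((Ioi (0 : ℝ)).indicator f) 1 volume :=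
    (memLp_one_iff_integrable).2 ((integrable_indicator_iff measurableSet_Ioi).2 hf)
  -- Approximation by a smooth compactly supported `φ` costs at most `ε/2`, uniformly on the closed
  -- half-plane; `ℒφ` itself decays like `1/|z|`.
  obtain ⟨φ, hc, hφ, hle⟩ := hfI.exist_eLpNorm_sub_le ENNReal.one_ne_top le_rfl (half_pos hε)
  have hφi : Integrable φ halfLine := (hφ.continuous.integrable_of_hasCompactSupport hc).restrict
  have hdiff : ∫ t, ‖(f - φ) t‖ ∂halfLine ≤ ε / 2 := by
    rw [integral_norm_eq_lintegral_enorm (hf.sub hφi).1]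
    refine ENNReal.toReal_le_of_le_ofReal (half_pos hε).le (le_trans ?_ hle)
    rw [eLpNorm_one_eq_lintegral_enorm]
    refine le_trans (le_of_eq ?_) (setLIntegral_le_lintegral (Ioi 0) _)
    refine setLIntegral_congr_fun measurableSet_Ioi fun t ht => ?_
    simp [indicator_of_mem ht]
  set M := ‖φ 0‖ + ∫ t, ‖deriv φ t‖ ∂halfLine
  -- The `1` ensures `z ≠ 0`, and `2M/ε` makes `M/|z| < ε/2`.
  have hbig := (tendsto_norm_cocompact_atTop (E := ℂ)).eventually_gt_atTop (max 1 (2 * M / ε))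
  filter_upwards [hbig.filter_mono inf_le_left,
    (eventually_principal.2 fun z hz => hz : ∀ᶠ z in 𝓟 {z : ℂ | 0 ≤ z.re}, 0 ≤ z.re).filter_mono
      inf_le_right] with z hz1 hz
  have hzpos : 0 < ‖z‖ := zero_lt_one.trans ((le_max_left _ _).trans_lt hz1)
  have h1 := norm_mul_norm_laplace_le (hφ.of_le (by exact_mod_cast le_top)) hc hz
  have h2 : 2 * M < ‖z‖ * ε := (div_lt_iff₀ hε).1 ((le_max_right _ _).trans_lt hz1)
  have h3 : ‖laplace φ z‖ < ε / 2 := by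
    refine lt_of_mul_lt_mul_left ?_ hzpos.le
    linarith
  have h4 : laplace f z = laplace (f - φ) z + laplace φ z := by
    have := integral_sub (integrable_exp_mul_of_re_nonneg hf hz)
      (integrable_exp_mul_of_re_nonneg hφi hz)
    simp only [← mul_sub] at this
    change laplace (f - φ) z = laplace f z - laplace φ z at this
    rw [this, sub_add_cancel]
  rw [dist_zero_right, h4]
  have h5 := (norm_laplace_le (hf.sub hφi) hz).trans hdiff
  exact (norm_add_le _ _).trans_lt (by linarith)

end A0

end CesaroHardy

/-! ### Assembly of the two intertwining identities. -/

namespace CesaroHardy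

lemma HasLaplaceTransform.congr {f g : ℝ → ℂ} {F : ℂ → ℂ} (h : HasLaplaceTransform g F)
    (hfg : f =ᵐ[halfLine] g) : HasLaplaceTransform f F := fun z hz => by
  refine ⟨(h z hz).1.congr ?_, (laplace_congr hfg z).trans (h z hz).2⟩
  filter_upwards [hfg] with t ht
  rw [ht]

lemma isA0_laplaceHardy {p q : ℝ≥0∞} [p.HolderConjugate q] [Fact (1 ≤ q)] (hp2 : p ≤ 2)
    {f : ℝ → ℂ} (hf : MemLp f p halfLine) (hq : q = ∞) :
    IsA0 (laplaceHardy hp2 hf : Hardy q) := by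
  have hp1 : p = 1 := by
    have := ENNReal.HolderConjugate.inv_add_inv_eq_one p q
    simpa [hq] using this
  have hfi : Integrable f halfLine := memLp_one_iff_integrable.1 (hp1 ▸ hf)
  -- The extension is the Laplace integral itself, which converges up to the boundary; the element
  -- of `Hardy q` is zero there.
  exact ⟨Hardy.differentiableOn _, laplace f, fun z hz => (laplaceHardy_apply hp2 hf hz).symm,
    continuousOn_laplace hfi, tendsto_laplace_cocompact hfi⟩

lemma hasLaplaceTransform_subordinated {p q : ℝ≥0∞} [p.HolderConjugate q] [Fact (1 ≤ p)]
    [Fact (1 ≤ q)] (hp2 : p ≤ 2) {k : ℝ → ℝ} (hk : Measurable k) (hki : Integrable k halfLine)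
    {f : ℝ → ℂ} (hfm : Measurable f) (hf : MemLp f p halfLine) (σ : ℝ) :
    HasLaplaceTransform (subordinated k p σ f)
      (∫ t, k t • Hardy.dilation (σ * t) (laplaceHardy hp2 hf : Hardy q) ∂halfLine : Hardy q) :=
  fun _ hz => ⟨integrable_exp_mul (q := q)
    (memLp_subordinated (ne_top_of_le_two hp2) hk hki hfm hf σ) hz,
    laplace_subordinated hp2 hk hki hfm hf σ hz⟩

theorem cesaroStar_laplace {α : ℝ} (hα : 0 < α) {p q : ℝ≥0∞} [p.HolderConjugate q]
    [Fact (1 ≤ p)] [Fact (1 ≤ q)] (hp2 : p ≤ 2) {f : ℝ → ℂ} (hf : MemLp f p halfLine) :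
    (∀ᵐ s ∂halfLine, IntegrableOn (cesaroStarIntegrand α f s) (Ioi s)) ∧
      MemLp (cesaroStar α f) p halfLine ∧
      ∃ F : Hardy q, HasLaplaceTransform f F ∧ (q = ∞ → IsA0 F) ∧
        Integrable (complexCesaroIntegrand α F) halfLine ∧
        HasLaplaceTransform (cesaroStar α f) (complexCesaro α F) := by
  have hpt := ne_top_of_le_two hp2
  have hp0 : p ≠ 0 := ENNReal.HolderConjugate.ne_zero p q
  -- A measurable representative is used throughout; each real operator at a point and each Laplace
  -- integral depends only on the almost everywhere class.
  obtain ⟨g, hgm, hfg⟩ := hf.aestronglyMeasurable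
  have hgm' := hgm.measurable
  have hg : MemLp g p halfLine := (memLp_congr_ae hfg).1 hf
  have hki := integrable_kernel (α := α) hα hp0 hpt
  have hk : Measurable (kernel α p) := measurable_kernel
  have hqp : q.HolderConjugate p := ENNReal.HolderConjugate.symm
  -- `complexCesaroIntegrand` takes its kernel exponent from `q` alone; this identifies it with `p`.
  have hconj : q.conjExponent = p := ENNReal.HolderConjugate.conjExponent_eq
  have hC : cesaroStar α f =ᵐ[halfLine] subordinated (kernel α p) p 1 g :=
    ae_halfLine fun s hs => by
      rw [← cesaroStar_eq_subordinated p hs, cesaroStar, cesaroStar,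
        integral_congr_ae (cesaroStarIntegrand_congr hfg hs)]
  have hint : complexCesaroIntegrand α (laplaceHardy hp2 hg : Hardy q) =
      fun t => kernel α p t • Hardy.dilation (1 * t) (laplaceHardy hp2 hg : Hardy q) := by
    ext t
    rw [complexCesaroIntegrand, hconj, one_mul]
  refine ⟨?_, (memLp_congr_ae hC).2 (memLp_subordinated hpt hk hki hgm' hg 1),
    laplaceHardy hp2 hg, (hasLaplaceTransform_laplaceHardy hp2 hg).congr hfg,
    isA0_laplaceHardy hp2 hg, ?_, ?_⟩
  · filter_upwards [ae_integrable_subordinated hpt hk hki hgm' hg 1,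
      ae_halfLine fun s hs => hs] with s hs hs0
    exact (integrableOn_cesaroStarIntegrand hα p hs0 hs).congr
      (cesaroStarIntegrand_congr hfg hs0).symm
  · rw [hint]
    exact integrable_dilation_laplaceHardy hp2 hki hgm' hg 1
  · rw [complexCesaro, hint]
    exact (hasLaplaceTransform_subordinated hp2 hk hki hgm' hg 1).congr hC

/-- The same argument with time reversed: the dilations act on `L_q` and `ℒ` maps into `H_p`, while
the kernel keeps the exponent `p`. -/
theorem cesaro_laplace {α : ℝ} (hα : 0 < α) {p q : ℝ≥0∞} [q.HolderConjugate p]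
    [Fact (1 ≤ p)] [Fact (1 ≤ q)] (hpt : p ≠ ∞) (hq2 : q ≤ 2) {f : ℝ → ℂ}
    (hf : MemLp f q halfLine) :
    (∀ᵐ s ∂halfLine, IntegrableOn (cesaroIntegrand α f s) (Ioo 0 s)) ∧
      MemLp (cesaro α f) q halfLine ∧
      ∃ F : Hardy p, HasLaplaceTransform f F ∧
        Integrable (complexCesaroStarIntegrand α F) halfLine ∧
        HasLaplaceTransform (cesaro α f) (complexCesaroStar α F) := by
  have hqt := ne_top_of_le_two hq2
  have hp0 : p ≠ 0 := ENNReal.HolderConjugate.ne_zero p q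
  have hq0 : q ≠ 0 := ENNReal.HolderConjugate.ne_zero q p
  have hpq : (p⁻¹).toReal + (q⁻¹).toReal = 1 := by
    rw [← ENNReal.toReal_add (ENNReal.inv_ne_top.2 hp0) (ENNReal.inv_ne_top.2 hq0), add_comm,
      ENNReal.HolderConjugate.inv_add_inv_eq_one, ENNReal.toReal_one]
  obtain ⟨g, hgm, hfg⟩ := hf.aestronglyMeasurable
  have hgm' := hgm.measurable
  have hg : MemLp g q halfLine := (memLp_congr_ae hfg).1 hf
  have hki := integrable_kernel (α := α) hα hp0 hpt
  have hk : Measurable (kernel α p) := measurable_kernel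
  have hC : cesaro α f =ᵐ[halfLine] subordinated (kernel α p) q (-1) g :=
    ae_halfLine fun s hs => by
      rw [← cesaro_eq_subordinated hpq hs, cesaro, cesaro,
        integral_congr_ae (cesaroIntegrand_congr hfg)]
  have hint : complexCesaroStarIntegrand α (laplaceHardy hq2 hg : Hardy p) =
      fun t => kernel α p t • Hardy.dilation (-1 * t) (laplaceHardy hq2 hg : Hardy p) := by
    ext t
    rw [complexCesaroStarIntegrand, neg_one_mul]
  refine ⟨?_, (memLp_congr_ae hC).2 (memLp_subordinated hqt hk hki hgm' hg (-1)),
    laplaceHardy hq2 hg, (hasLaplaceTransform_laplaceHardy hq2 hg).congr hfg, ?_, ?_⟩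
  · filter_upwards [ae_integrable_subordinated hqt hk hki hgm' hg (-1),
      ae_halfLine fun s hs => hs] with s hs hs0
    exact (integrableOn_cesaroIntegrand hα hpq hs0 hs).congr (cesaroIntegrand_congr hfg).symm
  · rw [hint]
    exact integrable_dilation_laplaceHardy hq2 hki hgm' hg (-1)
  · rw [complexCesaroStar, hint]
    exact (hasLaplaceTransform_subordinated hq2 hk hki hgm' hg (-1)).congr hC

end CesaroHardy

open CesaroHardy
theorem corollary2p5 (α : ℝ) (hα : 0 < α) :
    (∀ (p q : ℝ≥0∞) [Fact (1 ≤ q)], 1 ≤ p → p ≤ 2 → p⁻¹ + q⁻¹ = 1 →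
      ∀ f : ℝ → ℂ, MemLp f p halfLine →
        (∀ᵐ s ∂halfLine, IntegrableOn (cesaroStarIntegrand α f s) (Ioi s)) ∧
        MemLp (cesaroStar α f) p halfLine ∧
        ∃ F : Hardy q, HasLaplaceTransform f F ∧ (q = ∞ → IsA0 F) ∧
          Integrable (complexCesaroIntegrand α F) halfLine ∧
          HasLaplaceTransform (cesaroStar α f) (complexCesaro α F)) ∧
    (∀ (q p : ℝ≥0∞) [Fact (1 ≤ p)], 1 < q → q ≤ 2 → p⁻¹ + q⁻¹ = 1 →
      ∀ f : ℝ → ℂ, MemLp f q halfLine →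
        (∀ᵐ s ∂halfLine, IntegrableOn (cesaroIntegrand α f s) (Ioo 0 s)) ∧
        MemLp (cesaro α f) q halfLine ∧
        ∃ F : Hardy p, HasLaplaceTransform f F ∧
          Integrable (complexCesaroStarIntegrand α F) halfLine ∧
          HasLaplaceTransform (cesaro α f) (complexCesaroStar α F)) := by
  constructor
  · intro p q _ hp1 hp2 hpq f hf
    have : Fact (1 ≤ p) := ⟨hp1⟩
    have : p.HolderConjugate q := ENNReal.holderConjugate_iff.2 hpq
    exact cesaroStar_laplace hα hp2 hf
  · intro q p _ hq1 hq2 hpq f hf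
    have : Fact (1 ≤ q) := ⟨hq1.le⟩
    have hqp : q.HolderConjugate p := ENNReal.holderConjugate_iff.2 (by rwa [add_comm])
    -- This is where `q > 1` enters: for `p = ∞` the kernel tends to `α` at infinity and is not
    -- integrable.
    have hpt : p ≠ ∞ := ((ENNReal.HolderConjugate.lt_top_iff_one_lt p q).2 hq1).ne
    exact cesaro_laplace hα hpt hq2 hf
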